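/- **Setting.** Let $X$ be a reflexive real Banach space with dual $X^*$ whose norm is Fréchet differentiable (away from $0$) and satisfies $\|x+y\|^2\le\|x\|^2+\langle\nabla\|x\|^2,y\rangle+\|y\|^2$ for all $x,y\in X$, and let $\mathcal H\subseteq X$ be a convex set with non-empty interior (for instance $\mathcal H=X$). For a shape $\alpha\in[-\infty,1]$ let $\rho=\rho(\cdot;\alpha)$ be the Barron dispersion $$\rho(x;\alpha)=\begin{cases}\log(1+x^2/2),&\alpha=0,\\ 1-\exp(-x^2/2),&\alpha=-\infty,\\ \frac{|\alpha-2|}{\alpha}\Big(\big(1+\frac{x^2}{|\alpha-2|}\big)^{\alpha/2}-1\Big),&\text{otherwise,}\end{cases}$$ let $\sigma>0$, $\rho_\sigma(x)=\rho(x/\sigma)$ and $\theta,\eta\in\mathbb R$. Let $\mathsf L(h)$, $h\in\mathcal H$, be a random loss with law $\mu$ that is almost surely Fréchet differentiable at every point of $\mathcal H$, with gradient $\mathsf L'(h)\in X^*$, the loss and its gradient being jointly measurable in $h$ and the randomness. Assume that the T-risk $$\mathrm R_\rho(h;\theta,\eta)=\eta\theta+\mathbf E_\mu\,\rho_\sigma(\mathsf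 L(h)-\theta)$$ is finite on $\mathcal H$, write $\partial_h\mathrm R_\rho$ for its gradient as a function of $h\in\mathcal H$, and put $\partial_h\mathsf L_\rho(h;\theta,\eta)=\rho_\sigma'(\mathsf L(h)-\theta)\,\mathsf L'(h)$. Assume that, for some constants $\Gamma$ and $\lambda_1$, 1. $\|\partial_h\mathsf L_\rho(h;\theta,\eta)\|\le\Gamma$ almost surely, for every $h\in\mathcal H$; 2. $\mathbf E_\mu\|\mathsf L'(h_1)-\mathsf L'(h_2)\|\le\lambda_1\|h_1-h_2\|$ for all $h_1,h_2\in\mathcal H$; 3. $\mathbf E_\mu\|\mathsf L'\|_{\mathcal H}^2<\infty$, where $\|\mathsf L'\|_{\mathcal H}=\sup_{h\in\mathcal H}\|\mathsf L'(h)\|$. **Algorithm.** Let $\mathsf L_1,\mathsf L_2,\dots$ be independent copies of the random loss, $T\ge1$, $b=1-1/\sqrt T$, $a_t=(1/T)^{3/4}$, $h_1\in\mathcal H$ and $M_0=0$. For $t=1,\dots,T$ let $G_t=\partial_h\mathsf L_{\rho,t}(h_t;\theta,\eta)$ be the gradient $\partial_h\mathsf L_\rho$ computed with $\mathsf L_t$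 at $h_t$, and $$M_t=bM_{t-1}+(1-b)G_t,\qquad h_{t+1}=h_t-a_t\widetilde M_t,$$ where $\widetilde M_t\in X$ is any random direction with $\|\widetilde M_t\|=1$ and $\langle\widetilde M_t,M_t\rangle=\|M_t\|$ that is measurable with respect to the information available after $t$ draws (of which $\mathsf L_{t+1}$ is independent). Assume that $h_t\in\mathcal H$ for $1\le t\le T+1$. **Conclusion.** The map $h\mapsto\mathrm R_\rho(h;\theta,\eta)$ is differentiable on $\mathcal H$, and for every $0<\delta<1$, with probability at least $1-\delta$, $$\frac1T\sum_{t=1}^T\|\partial_h\mathrm R_\rho(h_t;\theta,\eta)\|\le\frac{c_1}{T^{1/4}}+\frac{c_2}{\sqrt T}+\frac{\lambda}{2T^{3/4}},$$ where $$c_1=\mathrm R_\rho(h_1;\theta,\eta)-\mathrm R_\rho(h_{T+1};\theta,\eta)+16\Gamma\sqrt{\log(3T/\delta)}+2\lambda,\qquad c_2=20\Gamma\log(3T/\delta)+2\Gamma,$$ $$\lambda=\frac{\lambda_3+\lambda_4}{\sigma}+\frac{\lambda_2}{\sigma^2}\mathbf E_\mu\|\mathsf L'\|_{\mathcal H},\quad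 \lambda_2=\|\rho''\|_\infty,\quad \lambda_3=\frac{2\lambda_2}{\sigma}\mathbf E_\mu\|\mathsf L'\|_{\mathcal H}^2,\quad \lambda_4=\lambda_1\|\rho'\|_\infty .$$ -/

import Mathlib

open MeasureTheory ProbabilityTheory
open scoped ENNReal

noncomputable section

namespace TRisk

/-- The Barron class `ρ(x; α)` of dispersion functions; the shape `⊥` stands for `α = -∞`. -/
def barron (α : WithBot ℝ) (x : ℝ) : ℝ :=
  WithBot.recBotCoe (C := fun _ => ℝ)
    (1 - Real.exp (-x ^ 2 / 2))
    (fun a : ℝ =>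
      if a = 2 then x ^ 2 / 2
      else if a = 0 then Real.log (1 + x ^ 2 / 2)
      else |a - 2| / a * ((1 + x ^ 2 / |a - 2|) ^ (a / 2) - 1))
    α

/-- The scaled dispersion `ρ_σ(x) = ρ(x / σ; α)`. -/
def barronScaled (α : WithBot ℝ) (σ x : ℝ) : ℝ := barron α (x / σ)

/-- `‖f‖_∞ = sup_x |f x|`. Only used for `ρ'` and `ρ''` with `α ≤ 1`, which are bounded. -/
def supNorm (f : ℝ → ℝ) : ℝ := ⨆ x, |f x|

section Space

variable {E : Type*} [NormedAddCommGroup E] [NormedSpace ℝ E]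

/-- A reflexive normed space: the canonical embedding into the bidual is onto. -/
def IsReflexive (E : Type*) [NormedAddCommGroup E] [NormedSpace ℝ E] : Prop :=
  Function.Surjective (NormedSpace.inclusionInDoubleDual ℝ E)

/-- The norm is Fréchet differentiable (away from the origin, where no norm is) and satisfies
`‖x + y‖² ≤ ‖x‖² + ⟨∇‖x‖², y⟩ + ‖y‖²`. -/
structure HasSmoothNorm (E : Type*) [NormedAddCommGroup E] [NormedSpace ℝ E] : Prop where
  differentiableAt_norm : ∀ x : E, x ≠ 0 → DifferentiableAt ℝ (fun y : E => ‖y‖) x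
  norm_add_sq_le : ∀ x y : E,
    ‖x + y‖ ^ 2 ≤ ‖x‖ ^ 2 + fderiv ℝ (fun v : E => ‖v‖ ^ 2) x y + ‖y‖ ^ 2

variable {Z : Type*}

/-- The gradient `L'(h; z)` of the base loss `h ↦ L(h; z)`, an element of the dual. -/
def lossGrad (L : E → Z → ℝ) (h : E) (z : Z) : StrongDual ℝ E :=
  fderiv ℝ (fun h' => L h' z) h

/-- The gradient of the transformed loss `η θ + ρ_σ(L(h; z) - θ)` with respect to `h`:
`ρ_σ'(L(h; z) - θ) L'(h; z)`. -/
def transformedGrad (α : WithBot ℝ) (σ θ : ℝ) (L : E → Z → ℝ) (h : E) (z : Z) :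
    StrongDual ℝ E :=
  deriv (barronScaled α σ) (L h z - θ) • lossGrad L h z

/-- `‖L'‖_H = sup_{h ∈ H} ‖L'(h; z)‖`, with values in `[0, ∞]`. -/
def gradSup (H : Set E) (L : E → Z → ℝ) (z : Z) : ℝ≥0∞ :=
  ⨆ h ∈ H, ‖lossGrad L h z‖ₑ

variable [MeasurableSpace Z]

/-- The T-risk `R(h; θ, η) = η θ + E ρ_σ(L(h) - θ)`. -/
def tRisk (μ : Measure Z) (α : WithBot ℝ) (σ θ η : ℝ) (L : E → Z → ℝ) (h : E) : ℝ :=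
  η * θ + ∫ z, barronScaled α σ (L h z - θ) ∂μ

/-- The gradient at `h` of the T-risk as a function on `H`. For a convex `H` with non-empty
interior it is unique; at interior points of `H` it is the usual Fréchet derivative. -/
def riskGrad (μ : Measure Z) (α : WithBot ℝ) (σ θ η : ℝ) (H : Set E) (L : E → Z → ℝ) (h : E) :
    StrongDual ℝ E :=
  fderivWithin ℝ (tRisk μ α σ θ η L) H h

/-- Standing properties of the random loss on `H`: joint measurability of the loss and of its
gradient, almost sure Fréchet differentiability, and a finite T-risk. -/
structure IsRandomLoss [MeasurableSpace E] (μ : Measure Z) (α : WithBot ℝ) (σ θ : ℝ)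
    (H : Set E) (L : E → Z → ℝ) : Prop where
  measurable_loss : Measurable (fun p : H × Z => L p.1 p.2)
  stronglyMeasurable_grad : StronglyMeasurable (fun p : H × Z => lossGrad L (p.1 : E) p.2)
  differentiable : ∀ᵐ z ∂μ, ∀ h ∈ H, DifferentiableAt ℝ (fun h' => L h' z) h
  integrable : ∀ h ∈ H, Integrable (fun z => barronScaled α σ (L h z - θ)) μ

/-- `E ‖L'‖_H² < ∞`. -/
structure HasGradSecondMoment (μ : Measure Z) (H : Set E) (L : E → Z → ℝ) : Prop where
  aemeasurable : AEMeasurable (gradSup H L) μ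
  lintegral_lt_top : ∫⁻ z, gradSup H L z ^ 2 ∂μ < ∞

/-- The smoothness coefficient
`λ = (λ₃ + λ₄) / σ + (λ₂ / σ²) E ‖L'‖_H`, where `λ₂ = ‖ρ''‖_∞`, `λ₃ = (2 λ₂ / σ) E ‖L'‖_H²`
and `λ₄ = λ₁ ‖ρ'‖_∞`; here `ρ = ρ(·; α)` is the unscaled dispersion. -/
def smoothCoeff (μ : Measure Z) (α : WithBot ℝ) (σ lam₁ : ℝ) (H : Set E) (L : E → Z → ℝ) : ℝ :=
  let lam₂ := supNorm (deriv (deriv (barron α)))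
  let lam₃ := (2 * lam₂ / σ) * (∫⁻ z, gradSup H L z ^ 2 ∂μ).toReal
  let lam₄ := lam₁ * supNorm (deriv (barron α))
  (lam₃ + lam₄) / σ + lam₂ / σ ^ 2 * (∫⁻ z, gradSup H L z ∂μ).toReal

end Space

/-- `ξ 1, ξ 2, …` are random draws with law `μ`, where `ℱ t` is the information available after
the first `t` draws and each new draw is independent of the past. The random losses are
`L_t(h) = L(h; ξ t)`. -/
structure IsSampleStream {Ω Z : Type*} [mΩ : MeasurableSpace Ω] [mZ : MeasurableSpace Z]
    (P : Measure Ω) (μ : Measure Z) (ℱ : Filtration ℕ mΩ) (ξ : ℕ → Ω → Z) : Prop where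
  measurable : ∀ t : ℕ, Measurable[ℱ (t + 1)] (ξ (t + 1))
  law : ∀ t : ℕ, P.map (ξ (t + 1)) = μ
  indep : ∀ t : ℕ, Indep (MeasurableSpace.comap (ξ (t + 1)) mZ) (ℱ t) P

/-- A run of `T` steps of normalized stochastic gradient descent with momentum parameter `b`,
constant step size `a` and initial point `h₁`, all iterates being in `H`. Here `h t`, `M t` and
`D t` are the `t`-th iterate, momentum and normalized update direction (`h 0` and `D 0` are not
used). Any choice of the direction `D t` that is a random element determined by the information
available after `t` draws is allowed. -/
structure IsNormalizedMomentumSGD {Ω Z E : Type*} [mΩ : MeasurableSpace Ω]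
    [NormedAddCommGroup E] [NormedSpace ℝ E]
    (ℱ : Filtration ℕ mΩ) (ξ : ℕ → Ω → Z) (α : WithBot ℝ) (σ θ : ℝ) (H : Set E)
    (L : E → Z → ℝ) (T : ℕ) (b a : ℝ) (h₁ : E)
    (h : ℕ → Ω → E) (M : ℕ → Ω → StrongDual ℝ E) (D : ℕ → Ω → E) : Prop where
  init : ∀ ω, h 1 ω = h₁
  mem : ∀ t ∈ Finset.Icc 1 (T + 1), ∀ ω, h t ω ∈ H
  momentum_zero : ∀ ω, M 0 ω = 0
  momentum : ∀ t ∈ Finset.Icc 1 T, ∀ ω,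
    M t ω = b • M (t - 1) ω + (1 - b) • transformedGrad α σ θ L (h t ω) (ξ t ω)
  direction_measurable : ∀ t ∈ Finset.Icc 1 T, StronglyMeasurable[ℱ t] (D t)
  direction_norm : ∀ t ∈ Finset.Icc 1 T, ∀ ω, ‖D t ω‖ = 1
  direction_dual : ∀ t ∈ Finset.Icc 1 T, ∀ ω, M t ω (D t ω) = ‖M t ω‖
  step : ∀ t ∈ Finset.Icc 1 T, ∀ ω, h (t + 1) ω = h t ω - a • D t ω

end TRisk

end

/-!
The inequality `‖x + y‖² ≤ ‖x‖² + ⟨∇‖x‖², y⟩ + ‖y‖²`, read at `y` and at `-y`, forces the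
parallelogram law, so the space and its dual are Hilbert spaces
(`TRisk.HasSmoothNorm.parallelogram_dual`). This gives dimension-free concentration for the
stochastic gradients by elementary means.

*Risk.* For `α ≤ 1` the Barron dispersion has bounded first and second derivatives
(`TRisk.exists_derivs_barron`). By dominated convergence, with `‖L'‖_H` as the dominating function,
the risk is differentiable on `H` with gradient the mean of `ρ_σ'(L - θ) L'`
(`TRisk.IsRandomLoss.hasFDerivWithinAt_tRisk`), and this gradient is `λ`-Lipschitz
(`TRisk.IsRandomLoss.norm_integral_transformedGrad_sub_le`).

*Algorithm.* By the descent lemma, a step along a direction norming the momentum `M_t` lowers the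
risk by at least `a (‖∇R‖ - 2 ‖M_t - ∇R‖) - λ a² / 2`
(`TRisk.step_le_of_lipschitz_fderivWithin`). Unrolling the recursion for `M_t` bounds `‖M_t - ∇R‖`
by an initial bias `b ^ t Γ`, a drift `λ a / (1 - b)` and the noise
`(1 - b) ‖∑ b ^ (t - s) (G_s - E G_s)‖` (`TRisk.norm_momentum_sub_le`); summing over `t` gives
the averaged bound (`TRisk.average_le_of_step`).

*Noise.* The noise is a Hilbert-space martingale `S` with bounded increments. Expanding
`‖S + f‖² = ‖S‖² + 2 ⟪S, f⟫ + ‖f‖²` and applying Hoeffding's lemma to the scalar `⟪S, f⟫` bounds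
`E exp (γ ‖S‖²)` step by step
(`TRisk.IsSampleStream.lintegral_exp_norm_sum_sq_le`), and Markov's inequality gives
`P (‖S‖² > 4 B l) ≤ exp (1 / 2 - l)` with `B` the sum of the squared bounds on the increments
(`TRisk.IsSampleStream.measure_norm_sum_sq_gt_le`). A union bound over `t ≤ T` with
`l = log (3 T / δ)` finishes the proof, since `√e ≤ 3`.
-/

namespace TRisk

/-! ### Derivatives of the Barron dispersions -/

/-- Every Barron dispersion of shape `α ≤ 1` is twice differentiable with bounded first and second
derivatives. For real `α` and `c = 2 - α`, `w = 1 + x² / c`, they are `x * w ^ (α / 2 - 1)` and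
`w ^ (α / 2 - 1) - x² * w ^ (α / 2 - 2)`, also at `α = 0`. -/
lemma exists_derivs_barron {α : WithBot ℝ} (hα : α ≤ 1) :
    ∃ (g g' : ℝ → ℝ) (C : ℝ), (∀ x, HasDerivAt (barron α) (g x) x) ∧
      (∀ x, HasDerivAt g (g' x) x) ∧ (∀ x, |g x| ≤ C) ∧ ∀ x, |g' x| ≤ C := by
  induction α using WithBot.recBotCoe with
  | bot =>
    have hq : ∀ x : ℝ, HasDerivAt (fun x : ℝ => -x ^ 2 / 2) (-x) x := fun x =>
      (((hasDerivAt_id x).pow 2).neg.div_const 2).congr_deriv (by simp; ring)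
    have hexp : ∀ x : ℝ, (1 + x ^ 2 / 2) * Real.exp (-x ^ 2 / 2) ≤ 1 := by
      intro x
      rw [neg_div, Real.exp_neg, ← div_eq_mul_inv, div_le_one (Real.exp_pos _), add_comm]
      exact Real.add_one_le_exp _
    refine ⟨fun x => x * Real.exp (-x ^ 2 / 2), fun x => (1 - x ^ 2) * Real.exp (-x ^ 2 / 2), 2,
      fun x => ?_, fun x => ?_, fun x => ?_, fun x => ?_⟩
    · exact ((hq x).exp.const_sub 1).congr_deriv (by ring)
    · exact ((hasDerivAt_id x).mul (hq x).exp).congr_deriv (by simp; ring)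
    · rw [abs_mul, Real.abs_exp]
      have : |x| ≤ 2 * (1 + x ^ 2 / 2) := by
        rw [abs_le]; constructor <;> nlinarith [sq_nonneg (x - 1), sq_nonneg (x + 1)]
      nlinarith [hexp x, mul_le_mul_of_nonneg_right this (Real.exp_pos (-x ^ 2 / 2)).le]
    · rw [abs_mul, Real.abs_exp]
      have : |1 - x ^ 2| ≤ 2 * (1 + x ^ 2 / 2) := by
        rw [abs_le]; constructor <;> nlinarith [sq_nonneg x]
      nlinarith [hexp x, mul_le_mul_of_nonneg_right this (Real.exp_pos (-x ^ 2 / 2)).le]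
  | coe a =>
    have ha : a ≤ 1 := by exact_mod_cast hα
    set c : ℝ := 2 - a with hc
    have hc1 : 1 ≤ c := by linarith
    have hc0 : 0 < c := by linarith
    have habs : |a - 2| = c := by rw [abs_of_nonpos (by linarith)]; ring
    have hw1 : ∀ x : ℝ, 1 ≤ 1 + x ^ 2 / c := fun x => by
      have : 0 ≤ x ^ 2 / c := by positivity
      linarith
    have hw0 : ∀ x : ℝ, 0 < 1 + x ^ 2 / c := fun x => by linarith [hw1 x]
    have hw : ∀ x : ℝ, HasDerivAt (fun x : ℝ => 1 + x ^ 2 / c) (2 * x / c) x := fun x =>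
      ((((hasDerivAt_id x).pow 2).div_const c).const_add 1).congr_deriv (by simp)
    have hpow : ∀ (p x : ℝ), HasDerivAt (fun x : ℝ => (1 + x ^ 2 / c) ^ p)
        (2 * x / c * p * (1 + x ^ 2 / c) ^ (p - 1)) x := fun p x =>
      (hw x).rpow_const (Or.inl (hw0 x).ne')
    refine ⟨fun x => x * (1 + x ^ 2 / c) ^ (a / 2 - 1),
      fun x => (1 + x ^ 2 / c) ^ (a / 2 - 1) - x ^ 2 * (1 + x ^ 2 / c) ^ (a / 2 - 2), 1 + c,
      fun x => ?_, fun x => ?_, fun x => ?_, fun x => ?_⟩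
    · have hb : barron (a : WithBot ℝ) = fun x : ℝ => if a = 2 then x ^ 2 / 2
          else if a = 0 then Real.log (1 + x ^ 2 / 2)
          else |a - 2| / a * ((1 + x ^ 2 / |a - 2|) ^ (a / 2) - 1) := rfl
      rw [hb, habs]
      by_cases h0 : a = 0
      · have hc2 : c = 2 := by rw [hc, h0]; ring
        simp only [h0, if_neg (by norm_num : ¬ (0 : ℝ) = 2), if_true]
        have := (hw x).log (hw0 x).ne'
        rw [hc2] at this ⊢
        refine this.congr_deriv ?_
        rw [show (0 : ℝ) / 2 - 1 = -1 by norm_num, Real.rpow_neg_one, div_eq_mul_inv]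
        ring
      · simp only [if_neg (by linarith : ¬ a = 2), if_neg h0]
        refine (((hpow (a / 2) x).sub_const 1).const_mul (c / a)).congr_deriv ?_
        field_simp
    · refine ((hasDerivAt_id x).mul (hpow (a / 2 - 1) x)).congr_deriv ?_
      have h2 : a / 2 - 1 = -c / 2 := by rw [hc]; ring
      rw [show a / 2 - 1 - 1 = a / 2 - 2 by ring, h2]
      simp only [id_eq, one_mul]
      field_simp
      ring
    · have hle : (1 + x ^ 2 / c) ^ (a / 2 - 1) ≤ (1 + x ^ 2 / c) ^ (-(1 / 2) : ℝ) :=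
        Real.rpow_le_rpow_of_exponent_le (hw1 x) (by linarith)
      rw [abs_mul, abs_of_pos (Real.rpow_pos_of_pos (hw0 x) _)]
      refine (mul_le_mul_of_nonneg_left hle (abs_nonneg x)).trans ?_
      rw [Real.rpow_neg (hw0 x).le, ← Real.sqrt_eq_rpow, ← div_eq_mul_inv,
        div_le_iff₀ (Real.sqrt_pos.2 (hw0 x))]
      refine abs_le_of_sq_le_sq ?_ (by positivity)
      rw [mul_pow, Real.sq_sqrt (hw0 x).le]
      have : x ^ 2 = c * (x ^ 2 / c) := by field_simp
      have h0 : 0 ≤ x ^ 2 / c := by positivity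
      nlinarith
    · have h1 : (1 + x ^ 2 / c) ^ (a / 2 - 1) ≤ 1 :=
        Real.rpow_le_one_of_one_le_of_nonpos (hw1 x) (by linarith)
      have h2 : (1 + x ^ 2 / c) ^ (a / 2 - 2) ≤ (1 + x ^ 2 / c)⁻¹ := by
        rw [← Real.rpow_neg_one]
        exact Real.rpow_le_rpow_of_exponent_le (hw1 x) (by linarith)
      have h3 : x ^ 2 * (1 + x ^ 2 / c) ^ (a / 2 - 2) ≤ c := by
        refine (mul_le_mul_of_nonneg_left h2 (sq_nonneg x)).trans ?_
        rw [← div_eq_mul_inv, div_le_iff₀ (hw0 x), mul_add, mul_div_cancel₀ _ hc0.ne']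
        linarith
      have h4 := (Real.rpow_pos_of_pos (hw0 x) (a / 2 - 1)).le
      have h5 := mul_nonneg (sq_nonneg x) (Real.rpow_pos_of_pos (hw0 x) (a / 2 - 2)).le
      rw [abs_le]
      constructor <;> linarith

lemma differentiable_barron {α : WithBot ℝ} (hα : α ≤ 1) : Differentiable ℝ (barron α) := by
  obtain ⟨g, g', C, hg, -⟩ := exists_derivs_barron hα
  exact fun x => (hg x).differentiableAt

lemma differentiable_deriv_barron {α : WithBot ℝ} (hα : α ≤ 1) :
    Differentiable ℝ (deriv (barron α)) := by
  obtain ⟨g, g', C, hg, hg', -⟩ := exists_derivs_barron hα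
  rw [show deriv (barron α) = g from funext fun x => (hg x).deriv]
  exact fun x => (hg' x).differentiableAt

lemma abs_deriv_barron_le {α : WithBot ℝ} (hα : α ≤ 1) (x : ℝ) :
    |deriv (barron α) x| ≤ supNorm (deriv (barron α)) := by
  obtain ⟨g, g', C, hg, hg', hC, hC'⟩ := exists_derivs_barron hα
  refine le_ciSup (f := fun x => |deriv (barron α) x|) ⟨C, ?_⟩ x
  rintro _ ⟨y, rfl⟩
  simpa [(hg y).deriv] using hC y

lemma abs_deriv_deriv_barron_le {α : WithBot ℝ} (hα : α ≤ 1) (x : ℝ) :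
    |deriv (deriv (barron α)) x| ≤ supNorm (deriv (deriv (barron α))) := by
  obtain ⟨g, g', C, hg, hg', hC, hC'⟩ := exists_derivs_barron hα
  have hd : deriv (barron α) = g := funext fun x => (hg x).deriv
  refine le_ciSup (f := fun x => |deriv (deriv (barron α)) x|) ⟨C, ?_⟩ x
  rintro _ ⟨y, rfl⟩
  simpa [hd, (hg' y).deriv] using hC' y

lemma supNorm_nonneg (f : ℝ → ℝ) : 0 ≤ supNorm f := Real.iSup_nonneg fun _ => abs_nonneg _

lemma hasDerivAt_barronScaled {α : WithBot ℝ} (hα : α ≤ 1) (σ x : ℝ) :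
    HasDerivAt (barronScaled α σ) (deriv (barron α) (x / σ) / σ) x := by
  have h := (differentiable_barron hα (x / σ)).hasDerivAt.comp x ((hasDerivAt_id x).div_const σ)
  exact h.congr_deriv (by rw [mul_one_div])

lemma deriv_barronScaled {α : WithBot ℝ} (hα : α ≤ 1) (σ x : ℝ) :
    deriv (barronScaled α σ) x = deriv (barron α) (x / σ) / σ :=
  (hasDerivAt_barronScaled hα σ x).deriv

lemma abs_deriv_barronScaled_le {α : WithBot ℝ} (hα : α ≤ 1) {σ : ℝ} (hσ : 0 < σ) (x : ℝ) :
    |deriv (barronScaled α σ) x| ≤ supNorm (deriv (barron α)) / σ := by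
  rw [deriv_barronScaled hα, abs_div, abs_of_pos hσ]
  gcongr
  exact abs_deriv_barron_le hα _

lemma abs_deriv_barronScaled_sub_le {α : WithBot ℝ} (hα : α ≤ 1) {σ : ℝ} (hσ : 0 < σ) (x y : ℝ) :
    |deriv (barronScaled α σ) x - deriv (barronScaled α σ) y|
      ≤ supNorm (deriv (deriv (barron α))) / σ ^ 2 * |x - y| := by
  have h := Convex.norm_image_sub_le_of_norm_deriv_le (f := deriv (barron α)) (s := Set.univ)
    (fun x _ => differentiable_deriv_barron hα x) (fun x _ => abs_deriv_deriv_barron_le hα x)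
    convex_univ (Set.mem_univ (y / σ)) (Set.mem_univ (x / σ))
  rw [Real.norm_eq_abs, Real.norm_eq_abs, ← sub_div, abs_div, abs_of_pos hσ] at h
  rw [deriv_barronScaled hα, deriv_barronScaled hα, ← sub_div, abs_div, abs_of_pos hσ,
    div_le_iff₀ hσ]
  refine h.trans_eq ?_
  field_simp

/-! ### Concentration of Hilbert-space martingales -/

section Concentration

lemma lintegral_comp_prodMk_of_indepFun {Ω Ω' Z : Type*} [MeasurableSpace Ω]
    [MeasurableSpace Ω'] [MeasurableSpace Z] {P : Measure Ω} [IsProbabilityMeasure P]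
    {Y : Ω → Ω'} {X : Ω → Z} (hY : Measurable Y) (hX : Measurable X) (hind : IndepFun Y X P)
    {f : Ω' × Z → ℝ≥0∞} (hf : Measurable f) :
    ∫⁻ ω, f (Y ω, X ω) ∂P = ∫⁻ ω, ∫⁻ z, f (Y ω, z) ∂(P.map X) ∂P := by
  have : IsProbabilityMeasure (P.map X) := Measure.isProbabilityMeasure_map hX.aemeasurable
  have hmap := (indepFun_iff_map_prod_eq_prod_map_map hY.aemeasurable hX.aemeasurable).1 hind
  rw [← lintegral_map hf (hY.prodMk hX), hmap, lintegral_prod _ hf.aemeasurable,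
    lintegral_map hf.lintegral_prod_right' hY]

/-- The next draw can be integrated out first: it is independent of the past. -/
lemma IsSampleStream.lintegral_comp {Ω Z : Type*} [mΩ : MeasurableSpace Ω]
    [mZ : MeasurableSpace Z] {P : Measure Ω} [IsProbabilityMeasure P] {μ : Measure Z}
    {ℱ : Filtration ℕ mΩ} {ξ : ℕ → Ω → Z} (hξ : IsSampleStream P μ ℱ ξ) (t : ℕ)
    {f : Ω × Z → ℝ≥0∞} (hf : Measurable[(ℱ t).prod mZ] f) :
    ∫⁻ ω, f (ω, ξ (t + 1) ω) ∂P = ∫⁻ ω, ∫⁻ z, f (ω, z) ∂μ ∂P := by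
  have hX : Measurable (ξ (t + 1)) := (hξ.measurable t).mono (ℱ.le _) le_rfl
  have hY : Measurable[mΩ, ℱ t] (id : Ω → Ω) := measurable_id'' (ℱ.le t)
  have hind : @IndepFun Ω Ω Z mΩ (ℱ t) mZ id (ξ (t + 1)) P := by
    refine (@IndepFun_iff_Indep Ω Ω Z mΩ (ℱ t) mZ id (ξ (t + 1)) P).2 ?_
    rw [MeasurableSpace.comap_id]
    exact (hξ.indep t).symm
  have h := @lintegral_comp_prodMk_of_indepFun Ω Ω Z mΩ (ℱ t) mZ P _ id (ξ (t + 1)) hY hX hind f hf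
  rwa [hξ.law t] at h

variable {V : Type*} [NormedAddCommGroup V] [InnerProductSpace ℝ V] [CompleteSpace V]

/-- One step of the exponential-moment recursion: expand the square and apply Hoeffding's lemma to
the scalar variable `⟪v, f⟫`, which is centred and lies in `[-‖v‖ c, ‖v‖ c]`. -/
lemma lintegral_exp_norm_add_sq_le {Z : Type*} [MeasurableSpace Z] {μ : Measure Z}
    [IsProbabilityMeasure μ] {f : Z → V} (hf : StronglyMeasurable f) {c : ℝ}
    (hc : ∀ᵐ z ∂μ, ‖f z‖ ≤ c) (h0 : ∫ z, f z ∂μ = 0) {γ : ℝ} (hγ : 0 ≤ γ) (v : V) :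
    ∫⁻ z, ENNReal.ofReal (Real.exp (γ * ‖v + f z‖ ^ 2)) ∂μ
      ≤ ENNReal.ofReal (Real.exp (γ * c ^ 2)) *
        ENNReal.ofReal (Real.exp ((γ + 2 * γ ^ 2 * c ^ 2) * ‖v‖ ^ 2)) := by
  have hfi : Integrable f μ := Integrable.of_bound hf.aestronglyMeasurable c hc
  have hX0 : ∫ z, inner ℝ v (f z) ∂μ = 0 := by rw [integral_inner hfi, h0, inner_zero_right]
  have hXm : AEMeasurable (fun z => inner ℝ v (f z)) μ :=
    (stronglyMeasurable_const.inner hf).measurable.aemeasurable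
  have hXb : ∀ᵐ z ∂μ, inner ℝ v (f z) ∈ Set.Icc (-(‖v‖ * c)) (‖v‖ * c) := by
    filter_upwards [hc] with z hz
    exact abs_le.1 ((abs_real_inner_le_norm v (f z)).trans
      (mul_le_mul_of_nonneg_left hz (norm_nonneg v)))
  have hsub := hasSubgaussianMGF_of_mem_Icc_of_integral_eq_zero hXm hXb hX0
  have hmgf := hsub.mgf_le (2 * γ)
  have hpar : (((‖‖v‖ * c - -(‖v‖ * c)‖₊ / 2) ^ 2 : NNReal) : ℝ) * (2 * γ) ^ 2 / 2
      = 2 * γ ^ 2 * c ^ 2 * ‖v‖ ^ 2 := by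
    push_cast
    rw [div_pow, Real.norm_eq_abs, sq_abs]
    ring
  rw [hpar] at hmgf
  calc ∫⁻ z, ENNReal.ofReal (Real.exp (γ * ‖v + f z‖ ^ 2)) ∂μ
      ≤ ∫⁻ z, ENNReal.ofReal (Real.exp (γ * (‖v‖ ^ 2 + c ^ 2))) *
          ENNReal.ofReal (Real.exp (2 * γ * inner ℝ v (f z))) ∂μ := by
        refine lintegral_mono_ae ?_
        filter_upwards [hc] with z hz
        rw [← ENNReal.ofReal_mul (Real.exp_pos _).le, ← Real.exp_add]
        gcongr
        rw [norm_add_sq_real]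
        have := pow_le_pow_left₀ (norm_nonneg _) hz 2
        nlinarith [mul_le_mul_of_nonneg_left this hγ]
    _ = ENNReal.ofReal (Real.exp (γ * (‖v‖ ^ 2 + c ^ 2))) *
          ENNReal.ofReal (mgf (fun z => inner ℝ v (f z)) μ (2 * γ)) := by
        rw [lintegral_const_mul' _ _ ENNReal.ofReal_ne_top, mgf,
          ofReal_integral_eq_lintegral_ofReal (hsub.integrable_exp_mul _)
            (Filter.Eventually.of_forall fun _ => (Real.exp_pos _).le)]
    _ ≤ ENNReal.ofReal (Real.exp (γ * (‖v‖ ^ 2 + c ^ 2))) *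
          ENNReal.ofReal (Real.exp (2 * γ ^ 2 * c ^ 2 * ‖v‖ ^ 2)) := by gcongr
    _ = _ := by
        rw [← ENNReal.ofReal_mul (Real.exp_pos _).le, ← ENNReal.ofReal_mul (Real.exp_pos _).le,
          ← Real.exp_add, ← Real.exp_add]
        ring_nf

variable {Ω Z : Type*} [mΩ : MeasurableSpace Ω] [mZ : MeasurableSpace Z]
  {P : Measure Ω} [IsProbabilityMeasure P] {μ : Measure Z} [IsProbabilityMeasure μ]
  {ℱ : Filtration ℕ mΩ} {ξ : ℕ → Ω → Z}

lemma IsSampleStream.stronglyMeasurable_sum {Ω Z W : Type*} [mΩ : MeasurableSpace Ω]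
    [mZ : MeasurableSpace Z] [NormedAddCommGroup W] {P : Measure Ω} {μ : Measure Z}
    {ℱ : Filtration ℕ mΩ} {ξ : ℕ → Ω → Z} (hξ : IsSampleStream P μ ℱ ξ) {f : ℕ → Ω → Z → W}
    {N : ℕ} (hf : ∀ s < N, StronglyMeasurable[(ℱ s).prod mZ] (Function.uncurry (f s)))
    {n : ℕ} (hn : n ≤ N) :
    StronglyMeasurable[ℱ n] (fun ω => ∑ s ∈ Finset.range n, f s ω (ξ (s + 1) ω)) := by
  refine Finset.stronglyMeasurable_fun_sum _ fun s hs => ?_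
  have hs := Finset.mem_range.1 hs
  have hX : Measurable[ℱ n] (ξ (s + 1)) := (hξ.measurable s).mono (ℱ.mono hs) le_rfl
  have hY : Measurable[ℱ n, ℱ s] (id : Ω → Ω) := measurable_id'' (ℱ.mono hs.le)
  have hYX : Measurable[ℱ n, (ℱ s).prod mZ] (fun ω => (ω, ξ (s + 1) ω)) :=
    @Measurable.prodMk Ω (ℱ n) Ω Z (ℱ s) mZ _ _ hY hX
  exact (hf s (by omega)).comp_measurable hYX

/-- Sub-Gaussian bound for the squared norm of a sum of bounded martingale differences in a Hilbert
space. The restriction on `γ` is what keeps the exponents `γ ↦ γ + 2 γ² c²` produced by the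
successive steps under control. -/
theorem IsSampleStream.lintegral_exp_norm_sum_sq_le (hξ : IsSampleStream P μ ℱ ξ)
    {f : ℕ → Ω → Z → V} {c : ℕ → ℝ} {N : ℕ}
    (hf : ∀ s < N, StronglyMeasurable[(ℱ s).prod mZ] (Function.uncurry (f s)))
    (hc : ∀ s < N, ∀ ω, ∀ᵐ z ∂μ, ‖f s ω z‖ ≤ c s)
    (h0 : ∀ s < N, ∀ ω, ∫ z, f s ω z ∂μ = 0) {n : ℕ} (hn : n ≤ N) {γ : ℝ} (hγ : 0 ≤ γ)
    (hγc : 4 * γ * ∑ s ∈ Finset.range n, c s ^ 2 ≤ 1) :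
    ∫⁻ ω, ENNReal.ofReal (Real.exp (γ * ‖∑ s ∈ Finset.range n, f s ω (ξ (s + 1) ω)‖ ^ 2)) ∂P
      ≤ ENNReal.ofReal (Real.exp (2 * γ * ∑ s ∈ Finset.range n, c s ^ 2)) := by
  induction n generalizing γ with
  | zero => simp
  | succ n ih =>
    have hn' : n < N := hn
    set B := ∑ s ∈ Finset.range n, c s ^ 2 with hB
    have hB0 : 0 ≤ B := Finset.sum_nonneg fun _ _ => sq_nonneg _
    simp only [Finset.sum_range_succ] at hγc ⊢
    rw [← hB] at hγc ⊢
    set S : Ω → V := fun ω => ∑ s ∈ Finset.range n, f s ω (ξ (s + 1) ω) with hS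
    have hSm : StronglyMeasurable[ℱ n] S := hξ.stronglyMeasurable_sum hf hn'.le
    have hm : Measurable[(ℱ n).prod mZ] (fun p : Ω × Z =>
        ENNReal.ofReal (Real.exp (γ * ‖S p.1 + Function.uncurry (f n) p‖ ^ 2))) := by
      let _ : MeasurableSpace Ω := ℱ n
      have h1 : StronglyMeasurable (fun p : Ω × Z => S p.1 + Function.uncurry (f n) p) :=
        (hSm.comp_measurable measurable_fst).add (hf n hn')
      have h2 := h1.norm.measurable
      fun_prop
    have hstep : ∀ ω, ∫⁻ z, ENNReal.ofReal (Real.exp (γ * ‖S ω + f n ω z‖ ^ 2)) ∂μ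
        ≤ ENNReal.ofReal (Real.exp (γ * c n ^ 2)) *
          ENNReal.ofReal (Real.exp ((γ + 2 * γ ^ 2 * c n ^ 2) * ‖S ω‖ ^ 2)) := fun ω =>
      lintegral_exp_norm_add_sq_le
        ((hf n hn').comp_measurable (@measurable_prodMk_left Ω Z (ℱ n) mZ ω)) (hc n hn' ω)
        (h0 n hn' ω) hγ (S ω)
    have hcn := sq_nonneg (c n)
    have hγ' : 4 * (γ + 2 * γ ^ 2 * c n ^ 2) * B ≤ 1 := by
      nlinarith [mul_nonneg hγ hcn, mul_nonneg hγ hB0,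
        mul_nonneg (mul_nonneg hγ hcn) (mul_nonneg hγ hB0)]
    calc ∫⁻ ω, ENNReal.ofReal (Real.exp (γ * ‖S ω + f n ω (ξ (n + 1) ω)‖ ^ 2)) ∂P
        = ∫⁻ ω, ∫⁻ z, ENNReal.ofReal (Real.exp (γ * ‖S ω + f n ω z‖ ^ 2)) ∂μ ∂P :=
          hξ.lintegral_comp n hm
      _ ≤ ∫⁻ ω, ENNReal.ofReal (Real.exp (γ * c n ^ 2)) *
            ENNReal.ofReal (Real.exp ((γ + 2 * γ ^ 2 * c n ^ 2) * ‖S ω‖ ^ 2)) ∂P :=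
          lintegral_mono hstep
      _ ≤ ENNReal.ofReal (Real.exp (γ * c n ^ 2)) *
            ENNReal.ofReal (Real.exp (2 * (γ + 2 * γ ^ 2 * c n ^ 2) * B)) := by
          rw [lintegral_const_mul' _ _ ENNReal.ofReal_ne_top]
          gcongr
          exact ih hn'.le (by positivity) hγ'
      _ ≤ ENNReal.ofReal (Real.exp (2 * γ * (B + c n ^ 2))) := by
          rw [← ENNReal.ofReal_mul (Real.exp_pos _).le, ← Real.exp_add]
          gcongr
          have h1 : 4 * γ * B ≤ 1 := by nlinarith [mul_nonneg hγ hcn]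
          nlinarith [mul_le_mul_of_nonneg_left h1 (mul_nonneg hγ hcn)]

/-- Hilbert-space Azuma–Hoeffding inequality, with non-optimal constants. -/
theorem IsSampleStream.measure_norm_sum_sq_gt_le (hξ : IsSampleStream P μ ℱ ξ)
    {f : ℕ → Ω → Z → V} {c : ℕ → ℝ} {n : ℕ}
    (hf : ∀ s < n, StronglyMeasurable[(ℱ s).prod mZ] (Function.uncurry (f s)))
    (hc : ∀ s < n, ∀ ω, ∀ᵐ z ∂μ, ‖f s ω z‖ ≤ c s)
    (h0 : ∀ s < n, ∀ ω, ∫ z, f s ω z ∂μ = 0) {B : ℝ}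
    (hB : ∑ s ∈ Finset.range n, c s ^ 2 ≤ B) (l : ℝ) :
    P {ω | 4 * B * l < ‖∑ s ∈ Finset.range n, f s ω (ξ (s + 1) ω)‖ ^ 2}
      ≤ ENNReal.ofReal (Real.exp (1 / 2 - l)) := by
  set S : Ω → V := fun ω => ∑ s ∈ Finset.range n, f s ω (ξ (s + 1) ω) with hS
  have hSm : Measurable (fun ω => ‖S ω‖) :=
    ((hξ.stronglyMeasurable_sum hf le_rfl).mono (ℱ.le n)).norm.measurable
  have hc0 : 0 ≤ ∑ s ∈ Finset.range n, c s ^ 2 := Finset.sum_nonneg fun _ _ => sq_nonneg _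
  rcases (hc0.trans hB).eq_or_lt with hB0 | hB0
  · -- All increments vanish: the exponential moment with `γ = 1` is at most one.
    have hsum : ∑ s ∈ Finset.range n, c s ^ 2 = 0 := le_antisymm (hB0 ▸ hB) hc0
    have h1 := hξ.lintegral_exp_norm_sum_sq_le hf hc h0 le_rfl zero_le_one (by simp [hsum])
    simp only [hsum, mul_zero, Real.exp_zero, one_mul] at h1
    have hm : Measurable (fun ω => ENNReal.ofReal (Real.exp (‖S ω‖ ^ 2))) := by fun_prop
    have h2 : (fun _ => 1) =ᵐ[P] fun ω => ENNReal.ofReal (Real.exp (‖S ω‖ ^ 2)) := by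
      refine ae_eq_of_ae_le_of_lintegral_le (Filter.Eventually.of_forall fun ω => ?_) (by simp)
        hm.aemeasurable (by simpa only [lintegral_one, measure_univ, ENNReal.ofReal_one] using h1)
      simp
    have h3 : P {ω | 4 * B * l < ‖S ω‖ ^ 2} = 0 := by
      refine measure_mono_null (fun ω hω => ?_) (ae_iff.1 h2)
      have hω : 4 * B * l < ‖S ω‖ ^ 2 := hω
      rw [← hB0, mul_zero, zero_mul] at hω
      have : 1 < ENNReal.ofReal (Real.exp (‖S ω‖ ^ 2)) := by
        rw [← ENNReal.ofReal_one]
        exact (ENNReal.ofReal_lt_ofReal_iff (Real.exp_pos _)).2 (Real.one_lt_exp_iff.2 hω)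
      exact this.ne
    rw [h3]
    exact bot_le
  · have hγ : 4 * (1 / (4 * B)) * ∑ s ∈ Finset.range n, c s ^ 2 ≤ 1 := by
      rw [show 4 * (1 / (4 * B)) = 1 / B by field_simp, one_div_mul_eq_div, div_le_one hB0]
      exact hB
    have h1 := hξ.lintegral_exp_norm_sum_sq_le hf hc h0 le_rfl
      (by positivity : 0 ≤ 1 / (4 * B)) hγ
    have hm : Measurable (fun ω => ENNReal.ofReal (Real.exp (1 / (4 * B) * ‖S ω‖ ^ 2))) := by
      fun_prop
    calc P {ω | 4 * B * l < ‖S ω‖ ^ 2}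
        ≤ P {ω | ENNReal.ofReal (Real.exp l)
            ≤ ENNReal.ofReal (Real.exp (1 / (4 * B) * ‖S ω‖ ^ 2))} := by
          refine measure_mono fun ω hω => ?_
          have hω : 4 * B * l < ‖S ω‖ ^ 2 := hω
          refine ENNReal.ofReal_le_ofReal (Real.exp_le_exp.2 ?_)
          rw [one_div_mul_eq_div, le_div_iff₀ (by positivity)]
          linarith
      _ ≤ (∫⁻ ω, ENNReal.ofReal (Real.exp (1 / (4 * B) * ‖S ω‖ ^ 2)) ∂P)
            / ENNReal.ofReal (Real.exp l) :=
          meas_ge_le_lintegral_div hm.aemeasurable (by simp [Real.exp_pos]) ENNReal.ofReal_ne_top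
      _ ≤ ENNReal.ofReal (Real.exp (1 / 2)) / ENNReal.ofReal (Real.exp l) := by
          gcongr
          refine h1.trans ?_
          gcongr
          linarith
      _ = _ := by rw [← ENNReal.ofReal_div_of_pos (Real.exp_pos _), ← Real.exp_sub]

end Concentration

/-! ### The norm inequality makes the space Hilbert -/

/-- Adding the smoothness inequality at `y` and `-y` cancels the derivative and leaves one half of
the parallelogram law; the substitution `(x + y, x - y)` gives the other half. -/
lemma HasSmoothNorm.parallelogram {E : Type*} [NormedAddCommGroup E] [NormedSpace ℝ E]
    (hE : HasSmoothNorm E) (x y : E) :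
    ‖x + y‖ * ‖x + y‖ + ‖x - y‖ * ‖x - y‖ = 2 * (‖x‖ * ‖x‖ + ‖y‖ * ‖y‖) := by
  have key : ∀ x y : E, ‖x + y‖ ^ 2 + ‖x - y‖ ^ 2 ≤ 2 * (‖x‖ ^ 2 + ‖y‖ ^ 2) := fun x y => by
    have h1 := hE.norm_add_sq_le x y
    have h2 := hE.norm_add_sq_le x (-y)
    rw [map_neg, norm_neg, ← sub_eq_add_neg] at h2
    linarith
  have h1 := key x y
  have h2 := key (x + y) (x - y)
  rw [add_add_sub_cancel, add_sub_sub_cancel, ← two_smul ℝ x, ← two_smul ℝ y, norm_smul,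
    norm_smul, Real.norm_two] at h2
  nlinarith

lemma parallelogram_strongDual {E : Type*} [NormedAddCommGroup E] [InnerProductSpace ℝ E]
    [CompleteSpace E] (f g : StrongDual ℝ E) :
    ‖f + g‖ * ‖f + g‖ + ‖f - g‖ * ‖f - g‖ = 2 * (‖f‖ * ‖f‖ + ‖g‖ * ‖g‖) := by
  simpa only [← sq, ← map_add, ← map_sub, LinearIsometryEquiv.norm_map] using
    parallelogram_law_with_norm ℝ ((InnerProductSpace.toDual ℝ E).symm f)
      ((InnerProductSpace.toDual ℝ E).symm g)

/-- The dual satisfies the parallelogram law too, by the Riesz isometry. -/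
lemma HasSmoothNorm.parallelogram_dual {E : Type*} [NormedAddCommGroup E] [NormedSpace ℝ E]
    [CompleteSpace E] (hE : HasSmoothNorm E) (f g : StrongDual ℝ E) :
    ‖f + g‖ * ‖f + g‖ + ‖f - g‖ * ‖f - g‖ = 2 * (‖f‖ * ‖f‖ + ‖g‖ * ‖g‖) :=
  @parallelogram_strongDual E _ (InnerProductSpace.ofNorm ℝ hE.parallelogram) _ f g

/-! ### Differentiability and smoothness of the risk -/

section Risk

variable {E Z : Type*} [NormedAddCommGroup E] [NormedSpace ℝ E] [MeasurableSpace E]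
  [MeasurableSpace Z] {μ : Measure Z} {α : WithBot ℝ} {σ θ : ℝ} {H : Set E} {L : E → Z → ℝ}

omit [MeasurableSpace E] in
lemma HasGradSecondMoment.ae_norm_lossGrad_le (hm : HasGradSecondMoment μ H L) :
    ∀ᵐ z ∂μ, ∀ h ∈ H, ‖lossGrad L h z‖ ≤ (gradSup H L z).toReal := by
  filter_upwards [ae_lt_top' (hm.aemeasurable.pow_const 2) hm.lintegral_lt_top.ne] with z hz h hh
  have hz' : gradSup H L z ≠ ∞ := fun h => by simp [h] at hz
  have : ‖lossGrad L h z‖ₑ ≤ gradSup H L z := le_iSup₂ (f := fun h _ => ‖lossGrad L h z‖ₑ) h hh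
  simpa using ENNReal.toReal_mono hz' this

omit [MeasurableSpace E] in
lemma HasGradSecondMoment.integrable_sq (hm : HasGradSecondMoment μ H L) :
    Integrable (fun z => (gradSup H L z).toReal ^ 2) μ := by
  simpa only [ENNReal.toReal_pow] using
    integrable_toReal_of_lintegral_ne_top (hm.aemeasurable.pow_const 2) hm.lintegral_lt_top.ne

omit [MeasurableSpace E] in
lemma HasGradSecondMoment.integral_sq (hm : HasGradSecondMoment μ H L) :
    ∫ z, (gradSup H L z).toReal ^ 2 ∂μ = (∫⁻ z, gradSup H L z ^ 2 ∂μ).toReal := by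
  have hp := hm.aemeasurable.pow_const 2
  rw [← integral_toReal hp (ae_lt_top' hp hm.lintegral_lt_top.ne)]
  simp only [ENNReal.toReal_pow]

omit [MeasurableSpace E] in
lemma HasGradSecondMoment.integrable [IsFiniteMeasure μ] (hm : HasGradSecondMoment μ H L) :
    Integrable (fun z => (gradSup H L z).toReal) μ := by
  refine ((integrable_const (1 : ℝ)).add hm.integrable_sq).mono'
    hm.aemeasurable.ennreal_toReal.aestronglyMeasurable (Filter.Eventually.of_forall fun z => ?_)
  rw [Real.norm_eq_abs, abs_of_nonneg ENNReal.toReal_nonneg]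
  simp only [Pi.add_apply]
  nlinarith [sq_nonneg ((gradSup H L z).toReal - 1)]

lemma IsRandomLoss.stronglyMeasurable_transformedGrad (hL : IsRandomLoss μ α σ θ H L) :
    StronglyMeasurable (fun p : H × Z => transformedGrad α σ θ L (p.1 : E) p.2) :=
  ((measurable_deriv (barronScaled α σ)).comp
    (hL.measurable_loss.sub_const θ)).stronglyMeasurable.smul hL.stronglyMeasurable_grad

lemma IsRandomLoss.stronglyMeasurable_transformedGrad_right (hL : IsRandomLoss μ α σ θ H L)
    {h : E} (hh : h ∈ H) : StronglyMeasurable (transformedGrad α σ θ L h) :=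
  hL.stronglyMeasurable_transformedGrad.comp_measurable
    (measurable_prodMk_left (x := (⟨h, hh⟩ : H)))

lemma IsRandomLoss.stronglyMeasurable_lossGrad_right (hL : IsRandomLoss μ α σ θ H L)
    {h : E} (hh : h ∈ H) : StronglyMeasurable (lossGrad L h) :=
  hL.stronglyMeasurable_grad.comp_measurable (measurable_prodMk_left (x := (⟨h, hh⟩ : H)))

lemma IsRandomLoss.hasFDerivAt_transformed (hL : IsRandomLoss μ α σ θ H L) (hα : α ≤ 1) :
    ∀ᵐ z ∂μ, ∀ h ∈ H, HasFDerivAt (fun h' => barronScaled α σ (L h' z - θ))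
      (transformedGrad α σ θ L h z) h := by
  filter_upwards [hL.differentiable] with z hz h hh
  exact ((hasDerivAt_barronScaled hα σ _).differentiableAt.hasDerivAt).comp_hasFDerivAt h
    ((hz h hh).hasFDerivAt.sub_const θ)

omit [MeasurableSpace E] in
lemma norm_transformedGrad_le (hα : α ≤ 1) (hσ : 0 < σ) (hm : HasGradSecondMoment μ H L) :
    ∀ᵐ z ∂μ, ∀ h ∈ H, ‖transformedGrad α σ θ L h z‖
      ≤ supNorm (deriv (barron α)) / σ * (gradSup H L z).toReal := by
  filter_upwards [hm.ae_norm_lossGrad_le] with z hz h hh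
  rw [transformedGrad, norm_smul, Real.norm_eq_abs]
  exact mul_le_mul (abs_deriv_barronScaled_le hα hσ _) (hz h hh) (norm_nonneg _)
    (div_nonneg (supNorm_nonneg _) hσ.le)

lemma IsRandomLoss.integrable_transformedGrad [IsFiniteMeasure μ] (hL : IsRandomLoss μ α σ θ H L)
    (hα : α ≤ 1) (hσ : 0 < σ) (hm : HasGradSecondMoment μ H L) {h : E} (hh : h ∈ H) :
    Integrable (transformedGrad α σ θ L h) μ := by
  refine (hm.integrable.const_mul (supNorm (deriv (barron α)) / σ)).mono'
    (hL.stronglyMeasurable_transformedGrad_right hh).aestronglyMeasurable ?_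
  filter_upwards [norm_transformedGrad_le hα hσ hm] with z hz using hz h hh

/-- Differentiation under the integral sign, within `H`: the difference quotients of the
transformed losses are dominated by a multiple of `‖L'‖_H`. -/
lemma IsRandomLoss.hasFDerivWithinAt_tRisk [IsFiniteMeasure μ] (hL : IsRandomLoss μ α σ θ H L)
    (hα : α ≤ 1) (hσ : 0 < σ) (hm : HasGradSecondMoment μ H L) (hconv : Convex ℝ H) (η : ℝ)
    {h : E} (hh : h ∈ H) :
    HasFDerivWithinAt (tRisk μ α σ θ η L) (∫ z, transformedGrad α σ θ L h z ∂μ) H h := by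
  set φ : E → Z → ℝ := fun h z => barronScaled α σ (L h z - θ) with hφ
  set G : E → Z → StrongDual ℝ E := transformedGrad α σ θ L with hG
  set C := supNorm (deriv (barron α)) / σ with hC
  set K : Z → ℝ := fun z => (gradSup H L z).toReal with hK
  have hGi : ∀ h ∈ H, Integrable (G h) μ := fun h hh => hL.integrable_transformedGrad hα hσ hm hh
  have hi : ∀ h' ∈ H, Integrable (fun z => φ h' z - φ h z - G h z (h' - h)) μ := fun h' hh' =>
    ((hL.integrable h' hh').sub (hL.integrable h hh)).sub ((hGi h hh).apply_continuousLinearMap _)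
  rw [hasFDerivWithinAt_iff_tendsto]
  have hlim : Filter.Tendsto
      (fun h' => ∫ z, ‖h' - h‖⁻¹ * ‖φ h' z - φ h z - G h z (h' - h)‖ ∂μ)
      (nhdsWithin h H) (nhds (∫ _, (0 : ℝ) ∂μ)) := by
    refine tendsto_integral_filter_of_dominated_convergence (fun z => 2 * (C * K z)) ?_ ?_
      ((hm.integrable.const_mul C).const_mul 2) ?_
    · filter_upwards [self_mem_nhdsWithin] with h' hh'
      exact ((hi h' hh').norm.const_mul _).aestronglyMeasurable
    · filter_upwards [self_mem_nhdsWithin] with h' hh'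
      filter_upwards [hL.hasFDerivAt_transformed hα, norm_transformedGrad_le hα hσ hm] with z hz hb
      have h1 : ‖φ h' z - φ h z‖ ≤ C * K z * ‖h' - h‖ :=
        hconv.norm_image_sub_le_of_norm_hasFDerivWithin_le (f := fun h => φ h z)
          (fun x hx => (hz x hx).hasFDerivWithinAt) hb hh hh'
      have h2 : ‖G h z (h' - h)‖ ≤ C * K z * ‖h' - h‖ :=
        ((G h z).le_opNorm _).trans (mul_le_mul_of_nonneg_right (hb h hh) (norm_nonneg _))
      rw [norm_mul, norm_inv, norm_norm, norm_norm]
      rcases (norm_nonneg (h' - h)).eq_or_lt with h0 | h0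
      · rw [← h0, inv_zero, zero_mul]
        have := (norm_nonneg _).trans (hb h hh)
        positivity
      · rw [inv_mul_le_iff₀ h0]
        refine (norm_sub_le _ _).trans ?_
        linarith
    · filter_upwards [hL.hasFDerivAt_transformed hα] with z hz
      exact hasFDerivWithinAt_iff_tendsto.1 (hz h hh).hasFDerivWithinAt
  rw [integral_zero] at hlim
  refine squeeze_zero' (Filter.Eventually.of_forall fun h' => by positivity) ?_ hlim
  filter_upwards [self_mem_nhdsWithin] with h' hh'
  rw [integral_const_mul]
  refine mul_le_mul_of_nonneg_left ?_ (by positivity)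
  have heq : tRisk μ α σ θ η L h' - tRisk μ α σ θ η L h - (∫ z, G h z ∂μ) (h' - h)
      = ∫ z, (φ h' z - φ h z - G h z (h' - h)) ∂μ := by
    have hφi : ∀ h ∈ H, Integrable (φ h) μ := hL.integrable
    rw [integral_sub (f := fun z => φ h' z - φ h z) ((hφi h' hh').sub (hφi h hh))
      ((hGi h hh).apply_continuousLinearMap _), integral_sub (hφi h' hh') (hφi h hh),
      ContinuousLinearMap.integral_apply (hGi h hh)]
    simp only [tRisk, hφ]
    ring
  rw [heq]
  exact norm_integral_le_integral_norm _

lemma IsRandomLoss.riskGrad_eq [IsFiniteMeasure μ] (hL : IsRandomLoss μ α σ θ H L)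
    (hα : α ≤ 1) (hσ : 0 < σ) (hm : HasGradSecondMoment μ H L) (hconv : Convex ℝ H)
    (hint : (interior H).Nonempty) (η : ℝ) {h : E} (hh : h ∈ H) :
    riskGrad μ α σ θ η H L h = ∫ z, transformedGrad α σ θ L h z ∂μ :=
  (hL.hasFDerivWithinAt_tRisk hα hσ hm hconv η hh).fderivWithin
    (uniqueDiffOn_convex hconv hint h hh)

/-- The mean gradient is Lipschitz: split
`ρ_σ'(L₁) L₁' - ρ_σ'(L₂) L₂' = ρ_σ'(L₁) (L₁' - L₂') + (ρ_σ'(L₁) - ρ_σ'(L₂)) L₂'`. -/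
lemma IsRandomLoss.norm_integral_transformedGrad_sub_le [IsFiniteMeasure μ]
    (hL : IsRandomLoss μ α σ θ H L)
    (hα : α ≤ 1) (hσ : 0 < σ) (hm : HasGradSecondMoment μ H L) (hconv : Convex ℝ H) {lam₁ : ℝ}
    (hsmooth : ∀ h₁ ∈ H, ∀ h₂ ∈ H,
      ∫ z, ‖lossGrad L h₁ z - lossGrad L h₂ z‖ ∂μ ≤ lam₁ * ‖h₁ - h₂‖)
    {h₁ h₂ : E} (hh₁ : h₁ ∈ H) (hh₂ : h₂ ∈ H) :
    ‖∫ z, transformedGrad α σ θ L h₁ z ∂μ - ∫ z, transformedGrad α σ θ L h₂ z ∂μ‖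
      ≤ smoothCoeff μ α σ lam₁ H L * ‖h₁ - h₂‖ := by
  set C := supNorm (deriv (barron α)) with hC
  set C₂ := supNorm (deriv (deriv (barron α))) with hC₂
  set K : Z → ℝ := fun z => (gradSup H L z).toReal with hK
  have hC0 : 0 ≤ C := supNorm_nonneg _
  have hC₂0 : 0 ≤ C₂ := supNorm_nonneg _
  have hdiff : Integrable (fun z => ‖lossGrad L h₁ z - lossGrad L h₂ z‖) μ := by
    refine (hm.integrable.const_mul 2).mono' ((hL.stronglyMeasurable_lossGrad_right hh₁).sub
      (hL.stronglyMeasurable_lossGrad_right hh₂)).norm.aestronglyMeasurable ?_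
    filter_upwards [hm.ae_norm_lossGrad_le] with z hz
    rw [norm_norm]
    linarith [norm_sub_le (lossGrad L h₁ z) (lossGrad L h₂ z), hz h₁ hh₁, hz h₂ hh₂]
  rw [← integral_sub (hL.integrable_transformedGrad hα hσ hm hh₁)
    (hL.integrable_transformedGrad hα hσ hm hh₂)]
  calc ‖∫ z, (transformedGrad α σ θ L h₁ z - transformedGrad α σ θ L h₂ z) ∂μ‖
      ≤ ∫ z, (C / σ * ‖lossGrad L h₁ z - lossGrad L h₂ z‖
          + C₂ / σ ^ 2 * ‖h₁ - h₂‖ * K z ^ 2) ∂μ := by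
        refine norm_integral_le_of_norm_le
          ((hdiff.const_mul _).add (hm.integrable_sq.const_mul _)) ?_
        filter_upwards [hL.differentiable, hm.ae_norm_lossGrad_le] with z hz hb
        have hloss : |L h₁ z - L h₂ z| ≤ K z * ‖h₁ - h₂‖ :=
          hconv.norm_image_sub_le_of_norm_hasFDerivWithin_le (f := fun h => L h z)
            (fun x hx => (hz x hx).hasFDerivAt.hasFDerivWithinAt) hb hh₂ hh₁
        have hsplit : transformedGrad α σ θ L h₁ z - transformedGrad α σ θ L h₂ z
            = deriv (barronScaled α σ) (L h₁ z - θ) • (lossGrad L h₁ z - lossGrad L h₂ z)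
              + (deriv (barronScaled α σ) (L h₁ z - θ) - deriv (barronScaled α σ) (L h₂ z - θ))
                • lossGrad L h₂ z := by
          simp only [transformedGrad]
          module
        rw [hsplit]
        refine (norm_add_le _ _).trans (add_le_add ?_ ?_)
        · rw [norm_smul]
          exact mul_le_mul_of_nonneg_right (abs_deriv_barronScaled_le hα hσ _) (norm_nonneg _)
        · rw [norm_smul]
          have h1 := abs_deriv_barronScaled_sub_le hα hσ (L h₁ z - θ) (L h₂ z - θ)
          rw [sub_sub_sub_cancel_right] at h1
          have h2 := h1.trans (mul_le_mul_of_nonneg_left hloss (by positivity))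
          refine (mul_le_mul h2 (hb h₂ hh₂) (norm_nonneg _) ((abs_nonneg _).trans h2)).trans_eq ?_
          ring
    _ = C / σ * ∫ z, ‖lossGrad L h₁ z - lossGrad L h₂ z‖ ∂μ
          + C₂ / σ ^ 2 * ‖h₁ - h₂‖ * (∫⁻ z, gradSup H L z ^ 2 ∂μ).toReal := by
        rw [integral_add (hdiff.const_mul _) (hm.integrable_sq.const_mul _), integral_const_mul,
          integral_const_mul, hm.integral_sq]
    _ ≤ C / σ * (lam₁ * ‖h₁ - h₂‖)
          + C₂ / σ ^ 2 * ‖h₁ - h₂‖ * (∫⁻ z, gradSup H L z ^ 2 ∂μ).toReal := by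
        gcongr
        exact hsmooth h₁ hh₁ h₂ hh₂
    _ ≤ smoothCoeff μ α σ lam₁ H L * ‖h₁ - h₂‖ := by
        set m₂ := (∫⁻ z, gradSup H L z ^ 2 ∂μ).toReal with hm₂
        set m₁ := (∫⁻ z, gradSup H L z ∂μ).toReal with hm₁
        have hm₂0 : 0 ≤ m₂ := ENNReal.toReal_nonneg
        have hm₁0 : 0 ≤ m₁ := ENNReal.toReal_nonneg
        have hlam : smoothCoeff μ α σ lam₁ H L
            = C / σ * lam₁ + C₂ / σ ^ 2 * m₂ + (C₂ / σ ^ 2 * m₂ + C₂ / σ ^ 2 * m₁) := by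
          simp only [smoothCoeff, ← hC, ← hC₂, ← hm₁, ← hm₂]
          field_simp
          ring
        rw [hlam]
        have : 0 ≤ (C₂ / σ ^ 2 * m₂ + C₂ / σ ^ 2 * m₁) * ‖h₁ - h₂‖ := by positivity
        linarith

end Risk

/-- Descent lemma for a function with Lipschitz gradient on a convex set, boundary points
included. -/
lemma le_add_of_lipschitz_fderivWithin {E : Type*} [NormedAddCommGroup E] [NormedSpace ℝ E]
    {H : Set E} (hconv : Convex ℝ H) {F : E → ℝ} {F' : E → StrongDual ℝ E} {lam : ℝ}
    (hF : ∀ x ∈ H, HasFDerivWithinAt F (F' x) H x)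
    (hlip : ∀ x ∈ H, ∀ y ∈ H, ‖F' x - F' y‖ ≤ lam * ‖x - y‖) {x v : E} (hx : x ∈ H)
    (hxv : x + v ∈ H) : F (x + v) ≤ F x + F' x v + lam / 2 * ‖v‖ ^ 2 := by
  have hmem : ∀ s ∈ Set.Icc (0 : ℝ) 1, x + s • v ∈ H := fun s hs =>
    hconv.add_smul_mem hx hxv hs
  have hd : ∀ s ∈ Set.Icc (0 : ℝ) 1, HasDerivWithinAt
      (fun s : ℝ => F (x + s • v) - s * F' x v - lam / 2 * ‖v‖ ^ 2 * s ^ 2)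
      (F' (x + s • v) v - F' x v - lam * ‖v‖ ^ 2 * s) (Set.Icc 0 1) s := by
    intro s hs
    have h1 : HasDerivWithinAt (fun s : ℝ => x + s • v) v (Set.Icc 0 1) s := by
      simpa using (((hasDerivAt_id s).smul_const v).const_add x).hasDerivWithinAt
    have h2 := (hF _ (hmem s hs)).comp_hasDerivWithinAt s h1 hmem
    have h3 := (hasDerivAt_id s).hasDerivWithinAt (s := Set.Icc 0 1) |>.mul_const (F' x v)
    have h4 := ((hasDerivAt_id s).pow 2).hasDerivWithinAt (s := Set.Icc 0 1)
      |>.const_mul (lam / 2 * ‖v‖ ^ 2)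
    refine ((h2.sub h3).sub h4).congr_deriv ?_
    simp
    ring
  have hanti := antitoneOn_of_deriv_nonpos (convex_Icc (0 : ℝ) 1)
    (fun s hs => (hd s hs).continuousWithinAt)
    (fun s hs => ((hd s (interior_subset hs)).mono interior_subset).differentiableWithinAt)
    (fun s hs => by
      have hs' := interior_subset hs
      rw [((hd s hs').hasDerivAt (mem_interior_iff_mem_nhds.1 hs)).deriv]
      have h1 := hlip _ (hmem s hs') x hx
      rw [add_sub_cancel_left, norm_smul, Real.norm_eq_abs, abs_of_nonneg hs'.1] at h1
      have h2 := (le_abs_self _).trans ((F' (x + s • v) - F' x).le_opNorm v)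
      rw [sub_apply] at h2
      nlinarith [mul_le_mul_of_nonneg_right h1 (norm_nonneg v)])
  have h := hanti (Set.left_mem_Icc.2 zero_le_one) (Set.right_mem_Icc.2 zero_le_one) zero_le_one
  simp at h
  linarith

/-! ### Pathwise analysis of the algorithm -/

/-- Error of an exponential moving average `m` of noisy observations `G` of slowly varying targets
`g`: an initial bias, a drift term, and the weighted noise. -/
lemma norm_momentum_sub_le {V : Type*} [NormedAddCommGroup V] [NormedSpace ℝ V] {m G g : ℕ → V}
    {T : ℕ} {b Γ κ : ℝ} (hb0 : 0 ≤ b) (hb1 : b < 1) (hm0 : m 0 = 0)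
    (hm : ∀ t ∈ Finset.Icc 1 T, m t = b • m (t - 1) + (1 - b) • G t)
    (hκ0 : 0 ≤ κ) (hκ : ∀ t ∈ Finset.Icc 1 T, ‖g t - g (t + 1)‖ ≤ κ) (hΓ : ‖g 1‖ ≤ Γ)
    {t : ℕ} (ht : t ∈ Finset.Icc 1 T) :
    ‖m t - g t‖ ≤ b ^ t * Γ + κ / (1 - b)
      + (1 - b) * ‖∑ s ∈ Finset.range t, b ^ (t - 1 - s) • (G (s + 1) - g (s + 1))‖ := by
  set N : ℕ → V := fun t => ∑ s ∈ Finset.range t, b ^ (t - 1 - s) • (G (s + 1) - g (s + 1)) with hN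
  have hb : 0 < 1 - b := by linarith
  have hN_succ : ∀ t, N (t + 1) = b • N t + (G (t + 1) - g (t + 1)) := fun t => by
    simp only [hN, Finset.sum_range_succ, Finset.smul_sum, smul_smul]
    congr 1
    · refine Finset.sum_congr rfl fun s hs => ?_
      have := Finset.mem_range.1 hs
      rw [← pow_succ', show t - 1 - s + 1 = t + 1 - 1 - s by omega]
    · simp
  have key : ∀ n, n + 1 ≤ T → ‖m (n + 1) - g (n + 1) - (1 - b) • N (n + 1)‖
      ≤ b ^ (n + 1) * Γ + κ / (1 - b) := by
    intro n
    induction n with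
    | zero =>
      intro h
      have h1 : m (0 + 1) - g (0 + 1) - (1 - b) • N (0 + 1) = -(b • g 1) := by
        rw [hm _ (Finset.mem_Icc.2 ⟨le_rfl, h⟩), hN_succ]
        simp only [hN, zero_add, Nat.sub_self, hm0, Finset.range_zero, Finset.sum_empty]
        module
      rw [h1, norm_neg, norm_smul, Real.norm_of_nonneg hb0, zero_add, pow_one]
      have : 0 ≤ κ / (1 - b) := by positivity
      nlinarith
    | succ n ih =>
      intro h
      have h1 : m (n + 1 + 1) - g (n + 1 + 1) - (1 - b) • N (n + 1 + 1)
          = b • ((m (n + 1) - g (n + 1) - (1 - b) • N (n + 1)) + (g (n + 1) - g (n + 1 + 1))) := by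
        rw [hm _ (Finset.mem_Icc.2 ⟨by omega, h⟩), hN_succ, Nat.add_sub_cancel]
        module
      rw [h1, norm_smul, Real.norm_of_nonneg hb0]
      have h2 := norm_add_le (m (n + 1) - g (n + 1) - (1 - b) • N (n + 1))
        (g (n + 1) - g (n + 1 + 1))
      have h3 := hκ (n + 1) (Finset.mem_Icc.2 ⟨by omega, by omega⟩)
      have h4 := mul_le_mul_of_nonneg_left (h2.trans (add_le_add (ih (by omega)) h3)) hb0
      have h5 : b * (κ / (1 - b) + κ) ≤ κ / (1 - b) := by
        rw [← sub_nonneg, show κ / (1 - b) - b * (κ / (1 - b) + κ) = κ * (1 - b) by field_simp; ring]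
        positivity
      rw [pow_succ]
      linarith
  obtain ⟨n, rfl⟩ : ∃ n, t = n + 1 := ⟨t - 1, by have := (Finset.mem_Icc.1 ht).1; omega⟩
  have h1 := norm_add_le (m (n + 1) - g (n + 1) - (1 - b) • N (n + 1)) ((1 - b) • N (n + 1))
  rw [sub_add_cancel, norm_smul, Real.norm_of_nonneg hb.le] at h1
  linarith [key n (Finset.mem_Icc.1 ht).2]

lemma sum_Icc_le_of_telescope {F u : ℕ → ℝ} {T : ℕ}
    (h : ∀ t ∈ Finset.Icc 1 T, u t ≤ F t - F (t + 1)) :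
    ∑ t ∈ Finset.Icc 1 T, u t ≤ F 1 - F (T + 1) := by
  induction T with
  | zero => simp
  | succ n ih =>
    rw [Finset.sum_Icc_succ_top (by omega)]
    have h1 := ih fun t ht => h t (Finset.Icc_subset_Icc_right n.le_succ ht)
    have h2 := h (n + 1) (Finset.mem_Icc.2 ⟨by omega, le_rfl⟩)
    linarith

/-- A step along a direction norming the momentum `m` decreases a smooth function, up to the error
of `m` as an estimate of the gradient. -/
lemma step_le_of_lipschitz_fderivWithin {E : Type*} [NormedAddCommGroup E] [NormedSpace ℝ E]
    {H : Set E} (hconv : Convex ℝ H) {F : E → ℝ} {F' : E → StrongDual ℝ E} {lam : ℝ}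
    (hF : ∀ x ∈ H, HasFDerivWithinAt F (F' x) H x)
    (hlip : ∀ x ∈ H, ∀ y ∈ H, ‖F' x - F' y‖ ≤ lam * ‖x - y‖) {x d : E} {m : StrongDual ℝ E}
    {a : ℝ} (ha : 0 ≤ a) (hd : ‖d‖ = 1) (hmd : m d = ‖m‖) (hx : x ∈ H) (hxd : x - a • d ∈ H) :
    a * ‖F' x‖ ≤ F x - F (x - a • d) + a * (2 * ‖m - F' x‖ + lam * a / 2) := by
  have h1 := le_add_of_lipschitz_fderivWithin hconv hF hlip (v := -(a • d)) hx
    (by rwa [← sub_eq_add_neg])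
  rw [← sub_eq_add_neg, map_neg, map_smul, norm_neg, norm_smul, hd, Real.norm_of_nonneg ha,
    smul_eq_mul] at h1
  have h2 := (le_abs_self _).trans ((m - F' x).le_opNorm d)
  rw [hd, sub_apply, hmd] at h2
  have h3 : ‖F' x‖ ≤ ‖m‖ + ‖m - F' x‖ := by
    simpa [norm_sub_rev] using norm_le_norm_add_norm_sub' (F' x) m
  nlinarith [mul_le_mul_of_nonneg_left (by linarith : ‖F' x‖ ≤ F' x d + 2 * ‖m - F' x‖) ha]

/-- Averaging the step inequality, for `T = q ^ 4`, step size `q⁻³` and momentum `1 - q⁻²`. -/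
lemma average_le_of_step {u e F : ℕ → ℝ} {T : ℕ} {q b Γ lam r : ℝ} (hq : 1 ≤ q)
    (hT : (T : ℝ) = q ^ 4) (hb : b = 1 - 1 / q ^ 2)
    (hΓ : 0 ≤ Γ)
    (hstep : ∀ t ∈ Finset.Icc 1 T, 1 / q ^ 3 * u t
      ≤ F t - F (t + 1) + 1 / q ^ 3 * (2 * e t + lam * (1 / q ^ 3) / 2))
    (he : ∀ t ∈ Finset.Icc 1 T, e t ≤ b ^ t * Γ + lam * (1 / q ^ 3) / (1 - b) + (1 - b) * r) :
    (1 / (T : ℝ)) * ∑ t ∈ Finset.Icc 1 T, u t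
      ≤ (F 1 - F (T + 1)) / q + 2 * Γ / q ^ 2 + 2 * lam / q + 2 * r / q ^ 2
        + lam / (2 * q ^ 3) := by
  have hq0 : 0 < q := by linarith
  have hb0 : 0 ≤ b := by
    rw [hb, sub_nonneg, div_le_one (by positivity)]
    exact one_le_pow₀ hq
  have hb1 : b < 1 := by
    have : 0 < 1 / q ^ 2 := by positivity
    linarith
  have hgeom : ∑ t ∈ Finset.Icc 1 T, b ^ t ≤ q ^ 2 := by
    have h1 : ∑ t ∈ Finset.Icc 1 T, b ^ t ≤ ∑ t ∈ Finset.range (T + 1), b ^ t :=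
      Finset.sum_le_sum_of_subset_of_nonneg
        (fun t ht => Finset.mem_range.2 (by have := (Finset.mem_Icc.1 ht).2; omega))
        fun _ _ _ => by positivity
    have h2 := (summable_geometric_of_lt_one hb0 hb1).sum_le_tsum (Finset.range (T + 1))
      fun _ _ => by positivity
    rw [tsum_geometric_of_lt_one hb0 hb1, hb, sub_sub_cancel, one_div, inv_inv, ← one_div, ← hb]
      at h2
    exact h1.trans h2
  have hsum : 1 / q ^ 3 * ∑ t ∈ Finset.Icc 1 T, u t ≤ F 1 - F (T + 1)
      + 1 / q ^ 3 * (2 * (q ^ 2 * Γ + q ^ 4 * (lam / q) + q ^ 4 * (r / q ^ 2))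
        + q ^ 4 * (lam / (2 * q ^ 3))) := by
    have h1 := sum_Icc_le_of_telescope (F := F) (T := T)
      (u := fun t => 1 / q ^ 3 * u t
        - 1 / q ^ 3 * (2 * (b ^ t * Γ + lam / q + r / q ^ 2) + lam / (2 * q ^ 3)))
      fun t ht => by
        have h2 : e t ≤ b ^ t * Γ + lam / q + r / q ^ 2 := (he t ht).trans_eq (by
          rw [hb, sub_sub_cancel]
          field_simp)
        have h3 : lam * (1 / q ^ 3) / 2 = lam / (2 * q ^ 3) := by field_simp
        have h4 := hstep t ht
        rw [h3] at h4
        have : 0 ≤ 1 / q ^ 3 := by positivity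
        nlinarith [mul_le_mul_of_nonneg_left h2 this]
    rw [Finset.sum_sub_distrib, ← Finset.mul_sum, ← Finset.mul_sum, Finset.sum_add_distrib,
      ← Finset.mul_sum, Finset.sum_add_distrib, Finset.sum_add_distrib, ← Finset.sum_mul] at h1
    simp only [Finset.sum_const, Nat.card_Icc, Nat.add_sub_cancel, nsmul_eq_mul, hT] at h1
    have h2 : 1 / q ^ 3 * ((∑ t ∈ Finset.Icc 1 T, b ^ t) * Γ) ≤ 1 / q ^ 3 * (q ^ 2 * Γ) := by
      gcongr
    linarith
  calc (1 / (T : ℝ)) * ∑ t ∈ Finset.Icc 1 T, u t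
      = 1 / q * (1 / q ^ 3 * ∑ t ∈ Finset.Icc 1 T, u t) := by rw [hT]; field_simp
    _ ≤ 1 / q * (F 1 - F (T + 1)
      + 1 / q ^ 3 * (2 * (q ^ 2 * Γ + q ^ 4 * (lam / q) + q ^ 4 * (r / q ^ 2))
        + q ^ 4 * (lam / (2 * q ^ 3)))) := by gcongr
    _ = _ := by field_simp; ring

/-! ### Concentration of the momentum noise -/

/-- The Azuma–Hoeffding inequality stated with the parallelogram law, so that it applies to a space
already carrying a normed structure. -/
lemma IsSampleStream.measure_norm_sum_sq_gt_le_of_parallelogram {Ω Z V : Type*}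
    [mΩ : MeasurableSpace Ω] [mZ : MeasurableSpace Z] [NormedAddCommGroup V] [NormedSpace ℝ V]
    [CompleteSpace V]
    (hV : ∀ x y : V, ‖x + y‖ * ‖x + y‖ + ‖x - y‖ * ‖x - y‖ = 2 * (‖x‖ * ‖x‖ + ‖y‖ * ‖y‖))
    {P : Measure Ω} [IsProbabilityMeasure P] {μ : Measure Z} [IsProbabilityMeasure μ]
    {ℱ : Filtration ℕ mΩ} {ξ : ℕ → Ω → Z} (hξ : IsSampleStream P μ ℱ ξ)
    {f : ℕ → Ω → Z → V} {c : ℕ → ℝ} {n : ℕ}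
    (hf : ∀ s < n, StronglyMeasurable[(ℱ s).prod mZ] (Function.uncurry (f s)))
    (hc : ∀ s < n, ∀ ω, ∀ᵐ z ∂μ, ‖f s ω z‖ ≤ c s)
    (h0 : ∀ s < n, ∀ ω, ∫ z, f s ω z ∂μ = 0) {B : ℝ}
    (hB : ∑ s ∈ Finset.range n, c s ^ 2 ≤ B) (l : ℝ) :
    P {ω | 4 * B * l < ‖∑ s ∈ Finset.range n, f s ω (ξ (s + 1) ω)‖ ^ 2}
      ≤ ENNReal.ofReal (Real.exp (1 / 2 - l)) :=
  @IsSampleStream.measure_norm_sum_sq_gt_le V _ (InnerProductSpace.ofNorm ℝ hV) _ Ω Z _ _ P _ μ _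
    ℱ ξ hξ f c n hf hc h0 B hB l

lemma IsRandomLoss.stronglyMeasurable_noise {E Z : Type*} [NormedAddCommGroup E]
    [NormedSpace ℝ E] [MeasurableSpace E] [BorelSpace E] [MeasurableSpace Z] {μ : Measure Z}
    {α : WithBot ℝ} {σ θ : ℝ} {H : Set E} {L : E → Z → ℝ} [SFinite μ]
    (hL : IsRandomLoss μ α σ θ H L) {Ω : Type*} [MeasurableSpace Ω] {k : Ω → E}
    (hk : StronglyMeasurable k) (hkH : ∀ ω, k ω ∈ H) (β : ℝ) :
    StronglyMeasurable (Function.uncurry fun ω z => β • (transformedGrad α σ θ L (k ω) z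
      - ∫ z, transformedGrad α σ θ L (k ω) z ∂μ)) := by
  have hm : Measurable (fun ω => (⟨k ω, hkH ω⟩ : H)) := hk.measurable.subtype_mk
  have hG : StronglyMeasurable (fun p : Ω × Z => transformedGrad α σ θ L (k p.1) p.2) :=
    hL.stronglyMeasurable_transformedGrad.comp_measurable
      ((hm.comp measurable_fst).prodMk measurable_snd)
  have hI : StronglyMeasurable (fun ω => ∫ z, transformedGrad α σ θ L (k ω) z ∂μ) :=
    StronglyMeasurable.integral_prod_right hG
  exact (hG.sub (hI.comp_measurable measurable_fst)).const_smul β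

section Run

variable {Ω Z E : Type*} [mΩ : MeasurableSpace Ω] [mZ : MeasurableSpace Z]
  [NormedAddCommGroup E] [NormedSpace ℝ E]
  {ℱ : Filtration ℕ mΩ} {ξ : ℕ → Ω → Z} {α : WithBot ℝ} {σ θ : ℝ} {H : Set E}
  {L : E → Z → ℝ} {T : ℕ} {b a : ℝ} {h₁ : E}
  {h : ℕ → Ω → E} {M : ℕ → Ω → StrongDual ℝ E} {D : ℕ → Ω → E}

omit mZ in
/-- The iterates are predictable. -/
lemma IsNormalizedMomentumSGD.stronglyMeasurable_iterate
    (hrun : IsNormalizedMomentumSGD ℱ ξ α σ θ H L T b a h₁ h M D) {t : ℕ} (ht : t ≤ T) :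
    StronglyMeasurable[ℱ t] (h (t + 1)) := by
  induction t with
  | zero =>
    rw [show h (0 + 1) = fun _ => h₁ from funext hrun.init]
    exact stronglyMeasurable_const
  | succ n ih =>
    have hn : n + 1 ∈ Finset.Icc 1 T := Finset.mem_Icc.2 ⟨by omega, ht⟩
    rw [show h (n + 1 + 1) = fun ω => h (n + 1) ω - a • D (n + 1) ω from funext (hrun.step _ hn)]
    exact ((ih (by omega)).mono (ℱ.mono n.le_succ)).sub
      ((hrun.direction_measurable _ hn).const_smul a)

lemma IsNormalizedMomentumSGD.measure_noise_gt_le [CompleteSpace E] [MeasurableSpace E]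
    [BorelSpace E] (hnorm : HasSmoothNorm E) {μ : Measure Z} [IsProbabilityMeasure μ]
    {P : Measure Ω} [IsProbabilityMeasure P] (hξ : IsSampleStream P μ ℱ ξ)
    (hL : IsRandomLoss μ α σ θ H L) {Γ : ℝ}
    (hΓ : ∀ h ∈ H, ∀ᵐ z ∂μ, ‖transformedGrad α σ θ L h z‖ ≤ Γ)
    (hrun : IsNormalizedMomentumSGD ℱ ξ α σ θ H L T b a h₁ h M D) (hb0 : 0 ≤ b) (hb1 : b < 1)
    {t : ℕ} (ht : t ≤ T) (l : ℝ) :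
    P {ω | 4 * (4 * Γ ^ 2 / (1 - b)) * l < ‖∑ s ∈ Finset.range t, b ^ (t - 1 - s) •
        (transformedGrad α σ θ L (h (s + 1) ω) (ξ (s + 1) ω)
          - ∫ z, transformedGrad α σ θ L (h (s + 1) ω) z ∂μ)‖ ^ 2}
      ≤ ENNReal.ofReal (Real.exp (1 / 2 - l)) := by
  have hmem : ∀ s < t, ∀ ω, h (s + 1) ω ∈ H := fun s hs ω =>
    hrun.mem _ (Finset.mem_Icc.2 ⟨by omega, by omega⟩) ω
  refine hξ.measure_norm_sum_sq_gt_le_of_parallelogram hnorm.parallelogram_dual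
    (f := fun s ω z => b ^ (t - 1 - s) • (transformedGrad α σ θ L (h (s + 1) ω) z
          - ∫ z, transformedGrad α σ θ L (h (s + 1) ω) z ∂μ))
    (c := fun s => b ^ (t - 1 - s) * (2 * Γ)) (fun s hs => ?_) (fun s hs ω => ?_)
    (fun s hs ω => ?_) ?_ l
  · exact @IsRandomLoss.stronglyMeasurable_noise E Z _ _ _ _ _ μ α σ θ H L _ hL Ω (ℱ s) _
      (hrun.stronglyMeasurable_iterate (by omega : s ≤ T)) (hmem s hs) _
  · filter_upwards [hΓ _ (hmem s hs ω)] with z hz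
    have h1 : ‖∫ z, transformedGrad α σ θ L (h (s + 1) ω) z ∂μ‖ ≤ Γ := by
      simpa using norm_integral_le_of_norm_le_const (hΓ _ (hmem s hs ω))
    rw [norm_smul, Real.norm_of_nonneg (by positivity)]
    gcongr
    exact (norm_sub_le _ _).trans (by linarith)
  · have hi : Integrable (transformedGrad α σ θ L (h (s + 1) ω)) μ :=
      Integrable.of_bound
        (hL.stronglyMeasurable_transformedGrad_right (hmem s hs ω)).aestronglyMeasurable Γ
        (hΓ _ (hmem s hs ω))
    rw [integral_smul, integral_sub hi (integrable_const _)]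
    simp
  · have h1 : ∀ k : ℕ, (b ^ k * (2 * Γ)) ^ 2 ≤ b ^ k * (4 * Γ ^ 2) := fun k => by
      have h2 : b ^ k ≤ 1 := pow_le_one₀ hb0 hb1.le
      have h3 : 0 ≤ b ^ k := by positivity
      nlinarith [mul_le_mul_of_nonneg_left h2 (by positivity : 0 ≤ b ^ k * (4 * Γ ^ 2))]
    calc ∑ s ∈ Finset.range t, (b ^ (t - 1 - s) * (2 * Γ)) ^ 2
        ≤ ∑ s ∈ Finset.range t, b ^ (t - 1 - s) * (4 * Γ ^ 2) :=
          Finset.sum_le_sum fun s _ => h1 _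
      _ = (∑ s ∈ Finset.range t, b ^ s) * (4 * Γ ^ 2) := by
          rw [← Finset.sum_mul, Finset.sum_range_reflect (fun s => b ^ s)]
      _ ≤ (1 - b)⁻¹ * (4 * Γ ^ 2) := by
          gcongr
          rw [← tsum_geometric_of_lt_one hb0 hb1]
          exact (summable_geometric_of_lt_one hb0 hb1).sum_le_tsum _ fun _ _ => by positivity
      _ = 4 * Γ ^ 2 / (1 - b) := by rw [inv_mul_eq_div]

end Run

/-- The union bound over `T` events of probability at most `exp (1 / 2 - log (3 T / δ))`. -/
lemma mul_exp_half_sub_log_le {T : ℕ} (hT : 1 ≤ T) {δ : ℝ} (hδ : 0 < δ) :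
    T * Real.exp (1 / 2 - Real.log (3 * T / δ)) ≤ δ := by
  have hT0 : (0 : ℝ) < T := by exact_mod_cast hT
  have h3 : Real.exp (1 / 2) ≤ 3 :=
    (Real.exp_le_exp.2 (by norm_num)).trans (Real.exp_one_lt_d9.le.trans (by norm_num))
  rw [Real.exp_sub, Real.exp_log (by positivity)]
  calc T * (Real.exp (1 / 2) / (3 * T / δ)) = Real.exp (1 / 2) / 3 * δ := by field_simp
    _ ≤ 1 * δ := by gcongr; linarith
    _ = δ := one_mul δ

end TRisk

/-! ### The convergence rate -/

theorem theorem1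
    {E : Type*} [NormedAddCommGroup E] [NormedSpace ℝ E] [CompleteSpace E]
    [MeasurableSpace E] [BorelSpace E]
    (hrefl : TRisk.IsReflexive E) (hnorm : TRisk.HasSmoothNorm E)
    (H : Set E) (hconv : Convex ℝ H) (hint : (interior H).Nonempty)
    {Z : Type*} [MeasurableSpace Z] (μ : Measure Z) [IsProbabilityMeasure μ]
    (α : WithBot ℝ) (hα : α ≤ 1) (σ : ℝ) (hσ : 0 < σ) (θ η : ℝ)
    (L : E → Z → ℝ) (hL : TRisk.IsRandomLoss μ α σ θ H L)
    (Γ : ℝ) (hΓ : ∀ h ∈ H, ∀ᵐ z ∂μ, ‖TRisk.transformedGrad α σ θ L h z‖ ≤ Γ)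
    (lam₁ : ℝ)
    (hsmooth : ∀ h₁ ∈ H, ∀ h₂ ∈ H,
      ∫ z, ‖TRisk.lossGrad L h₁ z - TRisk.lossGrad L h₂ z‖ ∂μ ≤ lam₁ * ‖h₁ - h₂‖)
    (hmoment : TRisk.HasGradSecondMoment μ H L)
    {Ω : Type*} [mΩ : MeasurableSpace Ω] (P : Measure Ω) [IsProbabilityMeasure P]
    (ℱ : Filtration ℕ mΩ) (ξ : ℕ → Ω → Z) (hξ : TRisk.IsSampleStream P μ ℱ ξ)
    (T : ℕ) (hT : 1 ≤ T) (h₁ : E)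
    (h : ℕ → Ω → E) (M : ℕ → Ω → StrongDual ℝ E) (D : ℕ → Ω → E)
    (hrun : TRisk.IsNormalizedMomentumSGD ℱ ξ α σ θ H L T
      (1 - 1 / Real.sqrt (T : ℝ)) ((1 / (T : ℝ)) ^ (3 / 4 : ℝ)) h₁ h M D)
    (δ : ℝ) (hδ0 : 0 < δ) (hδ1 : δ < 1) :
    DifferentiableOn ℝ (TRisk.tRisk μ α σ θ η L) H ∧
    ENNReal.ofReal (1 - δ) ≤ P {ω |
      let lam := TRisk.smoothCoeff μ α σ lam₁ H L
      let c₁ := TRisk.tRisk μ α σ θ η L (h 1 ω) - TRisk.tRisk μ α σ θ η L (h (T + 1) ω)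
        + 16 * Γ * Real.sqrt (Real.log (3 * T / δ)) + 2 * lam
      let c₂ := 20 * Γ * Real.log (3 * T / δ) + 2 * Γ
      (1 / (T : ℝ)) * ∑ t ∈ Finset.Icc 1 T, ‖TRisk.riskGrad μ α σ θ η H L (h t ω)‖
        ≤ c₁ / (T : ℝ) ^ (1 / 4 : ℝ) + c₂ / Real.sqrt T + lam / (2 * (T : ℝ) ^ (3 / 4 : ℝ))} := by
  have hT0 : (0 : ℝ) < T := by exact_mod_cast hT
  have hT1 : (1 : ℝ) ≤ T := by exact_mod_cast hT
  -- In terms of `q = T ^ (1 / 4)` every power of `T` is an integer power.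
  obtain ⟨q, hq⟩ : ∃ q : ℝ, q = (T : ℝ) ^ (1 / 4 : ℝ) := ⟨_, rfl⟩
  have hq1 : 1 ≤ q := hq ▸ Real.one_le_rpow hT1 (by norm_num)
  have hq0 : 0 < q := by linarith
  have hpow : ∀ n : ℕ, q ^ n = (T : ℝ) ^ (n / 4 : ℝ) := fun n => by
    rw [hq, ← Real.rpow_natCast, ← Real.rpow_mul hT0.le]
    ring_nf
  have hq4 : (T : ℝ) = q ^ 4 := by rw [hpow]; norm_num
  have hq3 : (T : ℝ) ^ (3 / 4 : ℝ) = q ^ 3 := by rw [hpow]; norm_num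
  have hq2 : Real.sqrt T = q ^ 2 := by rw [hpow, Real.sqrt_eq_rpow]; norm_num
  have ha : (1 / (T : ℝ)) ^ (3 / 4 : ℝ) = 1 / q ^ 3 := by
    rw [Real.div_rpow zero_le_one hT0.le, Real.one_rpow, hq3]
  rw [ha, hq2] at hrun
  obtain ⟨b, hb⟩ : ∃ b : ℝ, b = 1 - 1 / q ^ 2 := ⟨_, rfl⟩
  rw [← hb] at hrun
  have hb0 : 0 ≤ b := by
    rw [hb, sub_nonneg, div_le_one (by positivity)]
    exact one_le_pow₀ hq1
  have hb' : 1 - b = 1 / q ^ 2 := by rw [hb, sub_sub_cancel]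
  have hb1 : b < 1 := by
    have : 0 < 1 / q ^ 2 := by positivity
    linarith
  have hderiv : ∀ x ∈ H, HasFDerivWithinAt (TRisk.tRisk μ α σ θ η L)
      (∫ z, TRisk.transformedGrad α σ θ L x z ∂μ) H x := fun x hx =>
    hL.hasFDerivWithinAt_tRisk hα hσ hmoment hconv η hx
  refine ⟨fun x hx => (hderiv x hx).differentiableWithinAt, ?_⟩
  have hlip : ∀ x ∈ H, ∀ y ∈ H, ‖∫ z, TRisk.transformedGrad α σ θ L x z ∂μ
      - ∫ z, TRisk.transformedGrad α σ θ L y z ∂μ‖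
        ≤ TRisk.smoothCoeff μ α σ lam₁ H L * ‖x - y‖ := fun x hx y hy =>
    hL.norm_integral_transformedGrad_sub_le hα hσ hmoment hconv hsmooth hx hy
  have hΓI : ∀ x ∈ H, ‖∫ z, TRisk.transformedGrad α σ θ L x z ∂μ‖ ≤ Γ := fun x hx => by
    simpa using norm_integral_le_of_norm_le_const (hΓ x hx)
  have hΓ0 : 0 ≤ Γ := by
    obtain ⟨x, hx⟩ := hint
    exact (norm_nonneg _).trans (hΓI x (interior_subset hx))
  set lam := TRisk.smoothCoeff μ α σ lam₁ H L with hlam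
  set l := Real.log (3 * T / δ) with hl
  have hl0 : 0 ≤ l := Real.log_nonneg (by rw [le_div_iff₀ hδ0]; linarith)
  -- The momentum noise at time `t`, and the event that it is large at some time.
  set N : ℕ → Ω → StrongDual ℝ E := fun t ω => ∑ s ∈ Finset.range t, b ^ (t - 1 - s) •
    (TRisk.transformedGrad α σ θ L (h (s + 1) ω) (ξ (s + 1) ω)
      - ∫ z, TRisk.transformedGrad α σ θ L (h (s + 1) ω) z ∂μ) with hN
  set bad : Set Ω := ⋃ t ∈ Finset.Icc 1 T, {ω | 4 * (4 * Γ ^ 2 / (1 - b)) * l < ‖N t ω‖ ^ 2}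
    with hbad
  have hPbad : P bad ≤ ENNReal.ofReal δ := by
    calc P bad ≤ ∑ t ∈ Finset.Icc 1 T, P {ω | 4 * (4 * Γ ^ 2 / (1 - b)) * l < ‖N t ω‖ ^ 2} :=
          measure_biUnion_finset_le _ _
      _ ≤ ∑ _t ∈ Finset.Icc 1 T, ENNReal.ofReal (Real.exp (1 / 2 - l)) :=
          Finset.sum_le_sum fun t ht => hrun.measure_noise_gt_le hnorm hξ hL hΓ hb0 hb1
            (Finset.mem_Icc.1 ht).2 l
      _ = ENNReal.ofReal (T * Real.exp (1 / 2 - l)) := by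
          rw [Finset.sum_const, Nat.card_Icc, Nat.add_sub_cancel, nsmul_eq_mul,
            ENNReal.ofReal_mul hT0.le, ENNReal.ofReal_natCast]
      _ ≤ ENNReal.ofReal δ := ENNReal.ofReal_le_ofReal (TRisk.mul_exp_half_sub_log_le hT hδ0)
  rw [ENNReal.ofReal_sub _ hδ0.le, ENNReal.ofReal_one, tsub_le_iff_left]
  refine le_trans ?_ (add_le_add_left hPbad _)
  rw [← measure_univ (μ := P)]
  refine (measure_mono fun ω _ => ?_).trans (measure_union_le bad _)
  by_cases hω : ω ∈ bad
  · exact Or.inl hω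
  refine Or.inr ?_
  -- Off the bad event the estimate is deterministic.
  simp only [hbad, Set.mem_iUnion, Set.mem_ofPred_eq, not_exists, not_lt] at hω
  have hmem : ∀ t ∈ Finset.Icc 1 T, h t ω ∈ H := fun t ht =>
    hrun.mem t (Finset.Icc_subset_Icc_right T.le_succ ht) ω
  have hmem' : ∀ t ∈ Finset.Icc 1 T, h t ω - (1 / q ^ 3) • D t ω ∈ H := fun t ht => by
    rw [← hrun.step t ht ω]
    exact hrun.mem _ (Finset.mem_Icc.2 ⟨by omega, by have := (Finset.mem_Icc.1 ht).2; omega⟩) ω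
  have hq30 : 0 ≤ 1 / q ^ 3 := by positivity
  have hdrift : ∀ t ∈ Finset.Icc 1 T, ‖∫ z, TRisk.transformedGrad α σ θ L (h t ω) z ∂μ
      - ∫ z, TRisk.transformedGrad α σ θ L (h (t + 1) ω) z ∂μ‖ ≤ lam * (1 / q ^ 3) :=
    fun t ht => by
      rw [hrun.step t ht ω]
      refine (hlip _ (hmem t ht) _ (hmem' t ht)).trans_eq ?_
      rw [sub_sub_cancel, norm_smul, hrun.direction_norm t ht ω, Real.norm_of_nonneg hq30, mul_one]
  have h1T : 1 ∈ Finset.Icc 1 T := Finset.mem_Icc.2 ⟨le_rfl, hT⟩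
  have hmain := TRisk.average_le_of_step (F := fun t => TRisk.tRisk μ α σ θ η L (h t ω))
    (u := fun t => ‖∫ z, TRisk.transformedGrad α σ θ L (h t ω) z ∂μ‖)
    (e := fun t => ‖M t ω - ∫ z, TRisk.transformedGrad α σ θ L (h t ω) z ∂μ‖)
    (r := 4 * Γ * q * Real.sqrt l) (lam := lam) hq1 hq4 hb hΓ0
    (fun t ht => by
      have := TRisk.step_le_of_lipschitz_fderivWithin hconv hderiv hlip hq30
        (hrun.direction_norm t ht ω) (hrun.direction_dual t ht ω) (hmem t ht) (hmem' t ht)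
      rwa [← hrun.step t ht ω] at this)
    (fun t ht => by
      have hNt : ‖N t ω‖ ≤ 4 * Γ * q * Real.sqrt l := by
        refine le_of_sq_le_sq ((hω t ht).trans_eq ?_) (by positivity)
        rw [hb', mul_pow, Real.sq_sqrt hl0]
        field_simp
      refine (TRisk.norm_momentum_sub_le hb0 hb1 (m := fun t => M t ω)
        (G := fun t => TRisk.transformedGrad α σ θ L (h t ω) (ξ t ω))
        (g := fun t => ∫ z, TRisk.transformedGrad α σ θ L (h t ω) z ∂μ) (hrun.momentum_zero ω)
        (fun t ht => hrun.momentum t ht ω) ((norm_nonneg _).trans (hdrift 1 h1T)) hdrift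
        (hΓI _ (hmem 1 h1T)) ht).trans ?_
      exact add_le_add_right (mul_le_mul_of_nonneg_left hNt (by linarith)) _)
  simp only [Set.mem_ofPred_eq]
  rw [← hq, hq2, hq3]
  rw [Finset.sum_congr rfl fun t ht =>
    congrArg norm (hL.riskGrad_eq hα hσ hmoment hconv hint η (hmem t ht))]
  refine hmain.trans ?_
  -- Half of the first noise term and the whole of the second one are not needed.
  have hs : 0 ≤ 8 * Γ * Real.sqrt l / q := by positivity
  have hs' : 0 ≤ 20 * Γ * l / q ^ 2 := by positivity
  have hr : 2 * (4 * Γ * q * Real.sqrt l) / q ^ 2 = 8 * Γ * Real.sqrt l / q := by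
    field_simp
    ring
  rw [hr, add_div, add_div, add_div,
    show 16 * Γ * Real.sqrt l / q = 2 * (8 * Γ * Real.sqrt l / q) by ring]
  linarith
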